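/- Let $\mathbb{K}$ be a field of characteristic zero. A finite quasi-poset $P=(A,\leq_P)$ is a finite set $A$ with a reflexive transitive relation; write $x\sim_P y$ if $x\leq_P y$ and $y\leq_P x$, let $\overline{P}=A/\sim_P$ be the poset of classes and $cl(P)$ its cardinality, and let $top(P)$ be the set of upper sets of $P$, a topology on $A$; $P$ is connected if this topology is, and discrete if $\leq_P$ equals $\sim_P$. Let $\mathcal{H}_{\mathbf{qp}}$ be the vector space with basis the isomorphism classes of finite quasi-posets, with product $m$ the disjoint union (the unit is the empty quasi-poset) and the two coproducts $$\Delta(P)=\sum_{O\in top(P)} P_{|A\setminus O}\otimes P_{|O},\qquad \delta(P)=\sum_{\sim\,\triangleleft P} (P/\!\sim)\otimes (P|\!\sim).$$ Here, for an equivalence $\sim$ on $A$, $x\leq_{P|\sim}y$ means $x\leq_P y$ and $x\sim y$; $\leq_{P/\sim}$ is the transitive closure of the relation "$x\leq_P y$ or $x\sim y$"; and $\sim\triangleleft P$ means that $P$ restricted to each class of $\sim$ is connected and that $x\leq_{P/\sim}y\leq_{P/\sim}x$ implies $x\sim y$. The counit $\varepsilon$ of $\Delta$ is $1$ on the empty quasi-poset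 and $0$ on the others; the counit $\varepsilon'$ of $\delta$ is $1$ on discrete quasi-posets and $0$ on the others. On $\mathbb{K}[X]$, with its usual product $m$, let $\Delta(X)=X\otimes 1+1\otimes X$ (with counit $p\mapsto p(0)$) and $\delta(X)=X\otimes X$ (with counit $p\mapsto p(1)$), both extended multiplicatively. Let $ehr^{str}:\mathcal{H}_{\mathbf{qp}}\to\mathbb{K}[X]$ be the linear map sending $P$ to the polynomial $ehr^{str}_P$ such that, for every integer $k\geq 0$, $ehr^{str}_P(k)$ is the number of maps $f:A\to\{1,\ldots,k\}$ such that $x\leq_P y$ implies $f(x)\leq f(y)$, and $x\leq_P y$ together with $f(x)=f(y)$ implies $x\sim_P y$. Characters of $\mathcal{H}_{\mathbf{qp}}$ are algebra morphisms to $\mathbb{K}$; they form a monoid $M_{\mathbf{qp}}$ under $\chi*\psi=(\chi\otimes\psi)\circ\delta$, with unit $\varepsilon'$. For a linear map $\phi:\mathcal{H}_{\mathbf{qp}}\to\mathbb{K}[X]$ and $\chi\in M_{\mathbf{qp}}$, put $\phi\leftarrow\chi=(\phi\otimes\chi)\circ\delta$. Then: 1. $ehr^{str}$ is the unique map $\mathcal{H}_{\mathbf{qp}}\to\mathbb{K}[X]$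 that is both a Hopf algebra morphism from $(\mathcal{H}_{\mathbf{qp}},m,\Delta)$ to $(\mathbb{K}[X],m,\Delta)$ and a bialgebra morphism from $(\mathcal{H}_{\mathbf{qp}},m,\delta)$ to $(\mathbb{K}[X],m,\delta)$. 2. There is a unique Hopf algebra morphism $\phi_0:(\mathcal{H}_{\mathbf{qp}},m,\Delta)\to(\mathbb{K}[X],m,\Delta)$ such that $\phi_0(P)\in\mathbb{K}X^{cl(P)}$ for every $P$ and $\phi_0(P)=X$ if $cl(P)=1$. There is a unique character $\lambda$ with $\phi_0(P)=\lambda_P X^{cl(P)}$ for every $P$, and $\lambda_P=\mu_P/cl(P)!$, where $\mu_P$ is the number of order-preserving bijections $\overline{P}\to\{1,\ldots,cl(P)\}$. There is a unique character $\alpha^{str}$ with $ehr^{str}=\phi_0\leftarrow\alpha^{str}$, and $\alpha^{str}_P=\frac{d\,ehr^{str}_P}{dX}(0)$ for every connected $P$. The character $\alpha^{str}$ is the inverse of $\lambda$ in $M_{\mathbf{qp}}$: $\alpha^{str}*\lambda=\lambda*\alpha^{str}=\varepsilon'$. -/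

import Mathlib

open scoped TensorProduct Polynomial

/-- A finite quasi-poset: a finite set with a reflexive and transitive relation `≤`
(which need not be antisymmetric). -/
structure FinQuasiPoset where
  carrier : Type
  [finite : Finite carrier]
  [preorder : Preorder carrier]

namespace FinQuasiPoset

instance : CoeSort FinQuasiPoset Type := ⟨carrier⟩

instance (P : FinQuasiPoset) : Finite P := P.finite

instance (P : FinQuasiPoset) : Preorder P := P.preorder

/-- Two quasi-posets are isomorphic if there is a bijection which preserves and reflects `≤`. -/
instance isoSetoid : Setoid FinQuasiPoset where
  r P Q := Nonempty (P ≃o Q)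
  iseqv := ⟨fun P => ⟨OrderIso.refl P⟩, fun ⟨e⟩ => ⟨e.symm⟩, fun ⟨e⟩ ⟨f⟩ => ⟨e.trans f⟩⟩

/-! ### Operations on quasi-posets -/

/-- The empty quasi-poset. -/
def empty : FinQuasiPoset := ⟨Empty⟩

/-- The disjoint union: elements of different summands are not comparable. -/
def disjUnion (P Q : FinQuasiPoset) : FinQuasiPoset := ⟨P ⊕ Q⟩

/-- The restriction `P_{|B}` to a subset `B`. -/
def restrict (P : FinQuasiPoset) (B : Set P) : FinQuasiPoset := ⟨B⟩

/-- The quasi-poset on `n` elements all of whose elements are equivalent. -/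
def oneClass (n : ℕ) : FinQuasiPoset :=
  @mk (Fin n) inferInstance
    { le := fun _ _ => True
      lt := fun _ _ => False
      lt_iff_le_not_ge := fun _ _ => by simp
      le_refl := fun _ => trivial
      le_trans := fun _ _ _ _ _ => trivial }

/-- The quasi-poset `P | r`: `x ≤ y` if and only if `x ≤_P y` and `x r y`. -/
def restrictRel (P : FinQuasiPoset) (r : Setoid P) : FinQuasiPoset :=
  @mk P inferInstance
    { le := fun x y => x ≤ y ∧ r x y
      lt := fun x y => (x ≤ y ∧ r x y) ∧ ¬ (y ≤ x ∧ r y x)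
      lt_iff_le_not_ge := fun _ _ => Iff.rfl
      le_refl := fun x => ⟨le_refl x, r.refl x⟩
      le_trans := fun _ _ _ h₁ h₂ => ⟨h₁.1.trans h₂.1, r.trans h₁.2 h₂.2⟩ }

/-- The order relation of `P / r`: the transitive closure of `x ≤_P y` or `x r y`. -/
def contractLE (P : FinQuasiPoset) (r : Setoid P) : P → P → Prop :=
  Relation.TransGen fun x y => x ≤ y ∨ r x y

/-- The quasi-poset `P / r`; its underlying set is that of `P`. -/
def contract (P : FinQuasiPoset) (r : Setoid P) : FinQuasiPoset :=
  @mk P inferInstance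
    { le := P.contractLE r
      lt := fun x y => P.contractLE r x y ∧ ¬ P.contractLE r y x
      lt_iff_le_not_ge := fun _ _ => Iff.rfl
      le_refl := fun x => Relation.TransGen.single (Or.inl (le_refl x))
      le_trans := fun _ _ _ h₁ h₂ => Relation.TransGen.trans h₁ h₂ }

/-- `P` is connected if the topology whose open sets are the upper sets of `P` is connected
(in particular, `P` is non-empty). -/
def IsConnected (P : FinQuasiPoset) : Prop :=
  @ConnectedSpace P (Topology.upperSet P)

/-- `P` is discrete if its quasi-order is an equivalence relation. -/
def IsDiscrete (P : FinQuasiPoset) : Prop := ∀ x y : P, x ≤ y → y ≤ x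

/-- The relation `r ◁ P`: the restriction of `P` to each class of `r` is connected, and two elements
which are equivalent for the quasi-order of `P / r` are equivalent for `r`. -/
structure Compatible (P : FinQuasiPoset) (r : Setoid P) : Prop where
  connected : ∀ x : P, (P.restrict {y | r x y}).IsConnected
  equiv : ∀ x y : P, P.contractLE r x y → P.contractLE r y x → r x y

/-- The number of classes of the equivalence `x ≤ y ∧ y ≤ x`. -/
noncomputable def cl (P : FinQuasiPoset) : ℕ := Nat.card (Antisymmetrization P (· ≤ ·))

/-- The number of heap-orderings: the order-preserving bijections from the poset of classes of `P`
to `{0, …, cl P - 1}`. -/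
noncomputable def mu (P : FinQuasiPoset) : ℕ :=
  Nat.card {f : Antisymmetrization P (· ≤ ·) ≃ Fin P.cl // Monotone f}

/-! ### The strict Ehrhart polynomial -/

/-- The maps `f` from `P` to a set with `k` elements, totally ordered, which are non-decreasing and
such that `x ≤ y` and `f x = f y` imply that `x` and `y` are equivalent. -/
def strictMaps (P : FinQuasiPoset) (k : ℕ) : Set (P → Fin k) :=
  {f | (∀ x y, x ≤ y → f x ≤ f y) ∧ ∀ x y, x ≤ y → f x = f y → y ≤ x}

/-- The surjective elements of `strictMaps P k`. -/
def strictSurj (P : FinQuasiPoset) (k : ℕ) : Set (P → Fin k) :=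
  {f | f ∈ P.strictMaps k ∧ Function.Surjective f}

/-- The polynomial `X (X - 1) ⋯ (X - k + 1) / k!`. -/
noncomputable def hilbertPoly (K : Type*) [Field K] (k : ℕ) : K[X] :=
  Polynomial.C ((Nat.factorial k : K)⁻¹) * descPochhammer K k

/-- The strict Ehrhart polynomial of `P`. By `eval_ehrStrPoly` below, this is the polynomial
whose value at every `k : ℕ` is the number of elements of `strictMaps P k`. -/
noncomputable def ehrStrPoly (K : Type*) [Field K] (P : FinQuasiPoset) : K[X] :=
  ∑ i ∈ Finset.range (Nat.card P + 1), (Nat.card (P.strictSurj i) : K[X]) * hilbertPoly K i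


theorem eval_hilbertPoly (K : Type*) [Field K] [CharZero K] (i k : ℕ) :
    (hilbertPoly K i).eval (k : K) = (k.choose i : K) := by
  rw [hilbertPoly, Polynomial.eval_mul, Polynomial.eval_C, descPochhammer_eval_eq_descFactorial,
    Nat.descFactorial_eq_factorial_mul_choose, Nat.cast_mul,
    inv_mul_cancel_left₀ (Nat.cast_ne_zero.2 (Nat.factorial_ne_zero i))]

theorem card_strictMaps (P : FinQuasiPoset) (k : ℕ) :
    Nat.card (P.strictMaps k) =
      ∑ i ∈ Finset.range (k + 1), k.choose i * Nat.card (P.strictSurj i) := by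
  classical
  let _ : Fintype P := Fintype.ofFinite P
  let F : (Σ S : Finset (Fin k), P.strictSurj S.card) → P.strictMaps k := fun x =>
    ⟨fun p => x.1.orderEmbOfFin rfl (x.2.1 p),
      fun p q h => (x.1.orderEmbOfFin rfl).monotone (x.2.2.1.1 p q h),
      fun p q h h' => x.2.2.1.2 p q h ((x.1.orderEmbOfFin rfl).injective h')⟩
  have hF : Function.Bijective F := by
    constructor
    · rintro ⟨S, g, hg⟩ ⟨T, h, hh⟩ hST
      have h₀ : ∀ p, S.orderEmbOfFin rfl (g p) = T.orderEmbOfFin rfl (h p) := fun p =>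
        congrFun (congrArg Subtype.val hST) p
      have hrange : ∀ (S : Finset (Fin k)) (g : P → Fin S.card), Function.Surjective g →
          (S : Set (Fin k)) = Set.range fun p => S.orderEmbOfFin rfl (g p) := fun S g hg => by
        rw [← Finset.range_orderEmbOfFin S rfl]
        exact (hg.range_comp _).symm
      obtain rfl : S = T := by
        rw [← Finset.coe_inj, hrange S g hg.2, hrange T h hh.2]
        simp only [h₀]
      obtain rfl : g = h := funext fun p => (S.orderEmbOfFin rfl).injective (h₀ p)
      rfl
    · rintro ⟨f, hf⟩
      let S : Finset (Fin k) := Finset.univ.image f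
      have hS : ∀ p, f p ∈ S := fun p => Finset.mem_image_of_mem f (Finset.mem_univ p)
      let u := S.orderIsoOfFin rfl
      have hu : ∀ p, S.orderEmbOfFin rfl (u.symm ⟨f p, hS p⟩) = f p := fun p => by
        have : S.orderEmbOfFin rfl (u.symm ⟨f p, hS p⟩) = (u (u.symm ⟨f p, hS p⟩) : Fin k) := rfl
        rw [this, OrderIso.apply_symm_apply]
      refine ⟨⟨S, fun p => u.symm ⟨f p, hS p⟩, ⟨fun p q h => ?_, fun p q h h' => ?_⟩, ?_⟩, ?_⟩
      · exact u.symm.monotone (hf.1 p q h)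
      · exact hf.2 p q h (congrArg Subtype.val (u.symm.injective h'))
      · intro i
        obtain ⟨p, -, hp⟩ := Finset.mem_image.1 (u i).2
        refine ⟨p, ?_⟩
        rw [OrderIso.symm_apply_eq]
        exact Subtype.ext hp
      · exact Subtype.ext (funext hu)
  rw [← Nat.card_congr (Equiv.ofBijective F hF), Nat.card_sigma, ← Finset.powerset_univ,
    Finset.sum_powerset_apply_card fun i => Nat.card (P.strictSurj i)]
  simp

theorem card_strictSurj_eq_zero (P : FinQuasiPoset) {i : ℕ} (h : Nat.card P < i) :
    Nat.card (P.strictSurj i) = 0 := by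
  have : IsEmpty (P.strictSurj i) := ⟨fun f => by
    have := Nat.card_le_card_of_surjective f.1 f.2.2
    rw [Nat.card_fin] at this
    omega⟩
  exact Nat.card_of_isEmpty

theorem eval_ehrStrPoly (K : Type*) [Field K] [CharZero K] (P : FinQuasiPoset) (k : ℕ) :
    (P.ehrStrPoly K).eval (k : K) = (Nat.card (P.strictMaps k) : K) := by
  rw [card_strictMaps, ehrStrPoly, Polynomial.eval_finsetSum]
  simp only [Polynomial.eval_mul, Polynomial.eval_natCast, eval_hilbertPoly]
  push_cast
  have h₁ := Finset.sum_subset (f := fun i => (Nat.card (P.strictSurj i) : K) * (k.choose i : K))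
    (Finset.range_mono (show Nat.card P + 1 ≤ Nat.card P + k + 1 by omega)) fun i _ hi => by
      rw [card_strictSurj_eq_zero P (by simpa using hi), Nat.cast_zero, zero_mul]
  have h₂ := Finset.sum_subset (f := fun i => (Nat.card (P.strictSurj i) : K) * (k.choose i : K))
    (Finset.range_mono (show k + 1 ≤ Nat.card P + k + 1 by omega)) fun i _ hi => by
      rw [Nat.choose_eq_zero_of_lt (by simpa using hi), Nat.cast_zero, mul_zero]
  rw [h₁, ← h₂]
  exact Finset.sum_congr rfl fun i _ => mul_comm _ _

/-! ### Invariance under isomorphism -/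

section Invariance

variable {P Q : FinQuasiPoset}

theorem card_strictSurj_congr (e : P ≃o Q) (k : ℕ) :
    Nat.card (P.strictSurj k) = Nat.card (Q.strictSurj k) := by
  refine Nat.card_congr ((Equiv.arrowCongr e.toEquiv (Equiv.refl (Fin k))).subtypeEquiv ?_)
  intro f
  have hs : Function.Surjective f ↔ Function.Surjective (f ∘ e.symm) :=
    (e.symm.toEquiv.surjective_comp f).symm
  constructor
  · rintro ⟨⟨h₁, h₂⟩, h₃⟩
    refine ⟨⟨fun x y h => h₁ _ _ (e.symm.monotone h), fun x y h h' => ?_⟩, hs.1 h₃⟩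
    exact e.symm.le_iff_le.1 (h₂ _ _ (e.symm.monotone h) h')
  · rintro ⟨⟨h₁, h₂⟩, h₃⟩
    refine ⟨⟨fun x y h => ?_, fun x y h h' => ?_⟩, hs.2 h₃⟩
    · simpa using h₁ _ _ (e.monotone h)
    · exact e.le_iff_le.1 (h₂ _ _ (e.monotone h) (by simpa using h'))

theorem ehrStrPoly_congr (K : Type*) [Field K] (h : P ≈ Q) :
    P.ehrStrPoly K = Q.ehrStrPoly K := by
  obtain ⟨e⟩ := h
  simp only [ehrStrPoly, card_strictSurj_congr e, Nat.card_congr e.toEquiv]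

theorem isDiscrete_congr (h : P ≈ Q) : P.IsDiscrete ↔ Q.IsDiscrete := by
  have key : ∀ {P Q : FinQuasiPoset} (e : P ≃o Q), P.IsDiscrete → Q.IsDiscrete :=
    fun e h x y hxy => e.symm.le_iff_le.1 (h _ _ (e.symm.monotone hxy))
  obtain ⟨e⟩ := h
  exact ⟨key e, key e.symm⟩

theorem isConnected_of_iso (e : P ≃o Q) (h : P.IsConnected) : Q.IsConnected := by
  let _ : TopologicalSpace P := Topology.upperSet P
  let _ : TopologicalSpace Q := Topology.upperSet Q
  have _ : ConnectedSpace P := h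
  have hc : Continuous e := by
    refine ⟨fun s hs => ?_⟩
    exact fun x y hxy hx => hs (e.monotone hxy) hx
  exact e.surjective.connectedSpace hc

theorem disjUnion_congr {P P' Q Q' : FinQuasiPoset} (h : P ≈ P') (h' : Q ≈ Q') :
    P.disjUnion Q ≈ P'.disjUnion Q' := by
  obtain ⟨e⟩ := h
  obtain ⟨e'⟩ := h'
  refine ⟨⟨Equiv.sumCongr e.toEquiv e'.toEquiv, ?_⟩⟩
  rintro (x | x) (y | y)
  · exact Sum.inl_le_inl_iff.trans (e.le_iff_le.trans Sum.inl_le_inl_iff.symm)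
  · exact iff_of_false Sum.not_inl_le_inr Sum.not_inl_le_inr
  · exact iff_of_false Sum.not_inr_le_inl Sum.not_inr_le_inl
  · exact Sum.inr_le_inr_iff.trans (e'.le_iff_le.trans Sum.inr_le_inr_iff.symm)

theorem restrict_congr (e : P ≃o Q) (B : Set P) (C : Set Q) (h : ∀ x, x ∈ B ↔ e x ∈ C) :
    P.restrict B ≈ Q.restrict C :=
  ⟨⟨e.toEquiv.subtypeEquiv h, fun {_ _} => e.le_iff_le⟩⟩

/-- The transport of an equivalence relation along an isomorphism. -/
def setoidEquiv (e : P ≃o Q) : Setoid P ≃ Setoid Q where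
  toFun r := r.comap e.symm
  invFun r := r.comap e
  left_inv r := by ext x y; simp [Setoid.comap_rel]
  right_inv r := by ext x y; simp [Setoid.comap_rel]

theorem setoidEquiv_apply (e : P ≃o Q) (r : Setoid P) (x y : P) :
    r x y ↔ setoidEquiv e r (e x) (e y) := by
  change r x y ↔ r (e.symm (e x)) (e.symm (e y))
  simp

theorem contractLE_congr (e : P ≃o Q) (r : Setoid P) (x y : P) :
    Q.contractLE (setoidEquiv e r) (e x) (e y) ↔ P.contractLE r x y := by
  have h₁ := Relation.TransGen.lift (r := fun x y : P => x ≤ y ∨ r x y)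
    (p := fun x y : Q => x ≤ y ∨ setoidEquiv e r x y) e (fun a b hab =>
      hab.imp (fun h => e.monotone h) fun h => (setoidEquiv_apply e r a b).1 h) x y
  have h₂ := Relation.TransGen.lift (r := fun x y : Q => x ≤ y ∨ setoidEquiv e r x y)
    (p := fun x y : P => x ≤ y ∨ r x y) e.symm (fun a b hab =>
      hab.imp (fun h => e.symm.monotone h) fun h => h) (e x) (e y)
  simp only [Function.onFun, OrderIso.symm_apply_apply] at h₂
  exact ⟨h₂, h₁⟩

theorem contract_congr (e : P ≃o Q) (r : Setoid P) : P.contract r ≈ Q.contract (setoidEquiv e r) :=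
  ⟨⟨e.toEquiv, fun {x y} => contractLE_congr e r x y⟩⟩

theorem restrictRel_congr (e : P ≃o Q) (r : Setoid P) : P.restrictRel r ≈ Q.restrictRel (setoidEquiv e r) := by
  have h : ∀ x y : P, (e x ≤ e y ∧ setoidEquiv e r (e x) (e y)) ↔ (x ≤ y ∧ r x y) := fun x y => by
    rw [← setoidEquiv_apply e r, e.le_iff_le]
  exact ⟨⟨e.toEquiv, fun {x y} => h x y⟩⟩

theorem compatible_congr (e : P ≃o Q) (r : Setoid P) :
    P.Compatible r ↔ Q.Compatible (setoidEquiv e r) := by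
  have hr := setoidEquiv_apply e r
  have hc : ∀ x, P.restrict {y | r x y} ≈ Q.restrict {y | setoidEquiv e r (e x) y} :=
    fun x => restrict_congr e _ _ fun y => hr x y
  constructor
  · rintro ⟨h₁, h₂⟩
    refine ⟨fun x => ?_, fun x y => ?_⟩
    · obtain ⟨x, rfl⟩ := e.surjective x
      obtain ⟨f⟩ := hc x
      exact isConnected_of_iso f (h₁ x)
    · obtain ⟨x, rfl⟩ := e.surjective x
      obtain ⟨y, rfl⟩ := e.surjective y
      rw [contractLE_congr, contractLE_congr, ← hr]
      exact h₂ x y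
  · rintro ⟨h₁, h₂⟩
    refine ⟨fun x => ?_, fun x y => ?_⟩
    · obtain ⟨f⟩ := hc x
      exact isConnected_of_iso f.symm (h₁ (e x))
    · have := h₂ (e x) (e y)
      rwa [contractLE_congr, contractLE_congr, ← hr] at this

end Invariance

end FinQuasiPoset

/-! ### The vector space spanned by isoclasses of quasi-posets, with its product -/

/-- The isoclasses of finite quasi-posets. -/
def QPClass : Type 1 := Quotient FinQuasiPoset.isoSetoid

namespace QPClass

/-- The commutative monoid of isoclasses under disjoint union; its unit is the class of the empty
quasi-poset. -/
noncomputable instance : CommMonoid QPClass where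
  one := Quotient.mk _ FinQuasiPoset.empty
  mul := Quotient.map₂ FinQuasiPoset.disjUnion fun _ _ h _ _ h' =>
    FinQuasiPoset.disjUnion_congr h h'
  mul_assoc := by
    rintro ⟨P⟩ ⟨Q⟩ ⟨R⟩
    exact Quotient.sound ⟨OrderIso.sumAssoc P Q R⟩
  mul_comm := by
    rintro ⟨P⟩ ⟨Q⟩
    exact Quotient.sound ⟨OrderIso.sumComm P Q⟩
  one_mul := by
    rintro ⟨P⟩
    refine Quotient.sound ⟨⟨Equiv.emptySum Empty P, ?_⟩⟩
    rintro (x | x) (y | y)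
    · exact x.elim
    · exact x.elim
    · exact y.elim
    · exact Sum.inr_le_inr_iff.symm
  mul_one := by
    rintro ⟨P⟩
    refine Quotient.sound ⟨⟨Equiv.sumEmpty P Empty, ?_⟩⟩
    rintro (x | x) (y | y)
    · exact Sum.inl_le_inl_iff.symm
    · exact y.elim
    · exact x.elim
    · exact x.elim

end QPClass

/-- The algebra `H_qp`: formal linear combinations of isoclasses of finite quasi-posets, the product
being induced by disjoint union. (It is used only as an algebra: the coproduct which Mathlib puts
on every monoid algebra plays no role here.) -/
abbrev Hqp (K : Type*) [Field K] := MonoidAlgebra K QPClass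

namespace Hqp

open FinQuasiPoset

variable (K : Type*) [Field K]

/-- The isoclass of `P`, as a basis element of `H_qp`. -/
noncomputable def cls (P : FinQuasiPoset) : Hqp K :=
  MonoidAlgebra.single (Quotient.mk _ P : QPClass) 1

/-- The linear map on `H_qp` with prescribed values on the basis of isoclasses. -/
noncomputable def linExt {M : Type*} [AddCommGroup M] [Module K M] (F : QPClass → M) :
    Hqp K →ₗ[K] M :=
  Finsupp.linearCombination K F ∘ₗ (MonoidAlgebra.coeffLinearEquiv K).toLinearMap

/-- The linear map on `H_qp` with prescribed isomorphism-invariant values on quasi-posets. -/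
noncomputable def linLift {M : Type*} [AddCommGroup M] [Module K M] (F : FinQuasiPoset → M)
    (hF : ∀ P Q, P ≈ Q → F P = F Q) : Hqp K →ₗ[K] M :=
  linExt K (Quotient.lift F hF)

theorem linLift_cls {M : Type*} [AddCommGroup M] [Module K M] (F : FinQuasiPoset → M)
    (hF : ∀ P Q, P ≈ Q → F P = F Q) (P : FinQuasiPoset) : linLift K F hF (cls K P) = F P := by
  change Finsupp.linearCombination K (Quotient.lift F hF : QPClass → M)
    (Finsupp.single (Quotient.mk _ P : QPClass) 1) = F P
  rw [Finsupp.linearCombination_single, one_smul]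
  rfl

theorem cls_congr {P Q : FinQuasiPoset} (h : P ≈ Q) : cls K P = cls K Q :=
  congrArg (fun p : QPClass => MonoidAlgebra.single p (1 : K)) (Quotient.sound h)

/-! ### The two coproducts and their counits -/

/-- The sum of `[P_{|A∖O}] ⊗ [P_{|O}]` over the open sets `O` of `P`. -/
noncomputable def DeltaFun (P : FinQuasiPoset) : Hqp K ⊗[K] Hqp K :=
  ∑ᶠ O : UpperSet P, cls K (P.restrict {x | x ∉ O}) ⊗ₜ[K] cls K (P.restrict {x | x ∈ O})

/-- The sum of `[P / r] ⊗ [P | r]` over the equivalences `r ◁ P`. -/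
noncomputable def deltaFun (P : FinQuasiPoset) : Hqp K ⊗[K] Hqp K :=
  ∑ᶠ r : {r : Setoid P // P.Compatible r},
    cls K (P.contract r.1) ⊗ₜ[K] cls K (P.restrictRel r.1)

theorem DeltaFun_congr (P Q : FinQuasiPoset) (h : P ≈ Q) : DeltaFun K P = DeltaFun K Q := by
  obtain ⟨e⟩ := h
  unfold DeltaFun
  rw [← finsum_comp_equiv (UpperSet.map e).toEquiv]
  refine finsum_congr fun O => ?_
  rw [cls_congr K (restrict_congr e {x | x ∉ O} {x | x ∉ UpperSet.map e O} fun x => by simp),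
    cls_congr K (restrict_congr e {x | x ∈ O} {x | x ∈ UpperSet.map e O} fun x => by simp)]
  rfl

theorem deltaFun_congr (P Q : FinQuasiPoset) (h : P ≈ Q) : deltaFun K P = deltaFun K Q := by
  obtain ⟨e⟩ := h
  unfold deltaFun
  rw [← finsum_comp_equiv ((setoidEquiv e).subtypeEquiv (compatible_congr e))]
  refine finsum_congr fun r => ?_
  rw [cls_congr K (contract_congr e r.1), cls_congr K (restrictRel_congr e r.1)]
  rfl

/-- The coproduct `Δ` of `H_qp`. -/
noncomputable def Delta : Hqp K →ₗ[K] Hqp K ⊗[K] Hqp K :=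
  linLift K (DeltaFun K) (DeltaFun_congr K)

open Classical in
/-- The counit `ε` of `Δ`: `1` on the empty quasi-poset, `0` on the others. -/
noncomputable def eps : Hqp K →ₗ[K] K :=
  linLift K (fun P => if IsEmpty P then 1 else 0) fun P Q ⟨e⟩ => by
    simp only [e.toEquiv.isEmpty_congr]

/-- The coproduct `δ` of `H_qp`. -/
noncomputable def delta : Hqp K →ₗ[K] Hqp K ⊗[K] Hqp K :=
  linLift K (deltaFun K) (deltaFun_congr K)

open Classical in
/-- The counit `ε'` of `δ`: `1` on the discrete quasi-posets, `0` on the others. -/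
noncomputable def eps' : Hqp K →ₗ[K] K :=
  linLift K (fun P => if P.IsDiscrete then 1 else 0) fun P Q h => by
    simp only [isDiscrete_congr h]

/-- The linear map `ehr^str : H_qp → K[X]`. -/
noncomputable def ehrStr : Hqp K →ₗ[K] K[X] :=
  linLift K (ehrStrPoly K) fun _ _ h => ehrStrPoly_congr K h

end Hqp

/-! ### The two coproducts of `K[X]` -/

namespace PolyBialg

variable (K : Type*) [Field K]

/-- The algebra morphism `Δ` with `Δ X = X ⊗ 1 + 1 ⊗ X`. -/
noncomputable def Delta : K[X] →ₗ[K] K[X] ⊗[K] K[X] :=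
  (Polynomial.aeval ((Polynomial.X : K[X]) ⊗ₜ[K] (1 : K[X]) +
    (1 : K[X]) ⊗ₜ[K] (Polynomial.X : K[X]))).toLinearMap

/-- The counit of `Δ`: evaluation at `0`. -/
noncomputable def eps : K[X] →ₗ[K] K := (Polynomial.aeval (0 : K)).toLinearMap

/-- The algebra morphism `δ` with `δ X = X ⊗ X`. -/
noncomputable def delta : K[X] →ₗ[K] K[X] ⊗[K] K[X] :=
  (Polynomial.aeval ((Polynomial.X : K[X]) ⊗ₜ[K] (Polynomial.X : K[X]))).toLinearMap

/-- The counit of `δ`: evaluation at `1`. -/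
noncomputable def eps' : K[X] →ₗ[K] K := (Polynomial.aeval (1 : K)).toLinearMap

end PolyBialg

/-! ### Morphisms and characters -/

/-- `φ : A → B` is a morphism of bialgebras, `A` and `B` being algebras equipped with the coproducts
`ΔA`, `ΔB` and the counits `εA`, `εB`. (Between Hopf algebras, these are the morphisms of Hopf
algebras: the compatibility with the antipodes is automatic.) -/
structure IsBialgebraMorphism {K A B : Type*} [Field K] [Ring A] [Algebra K A] [Ring B]
    [Algebra K B] (ΔA : A →ₗ[K] A ⊗[K] A) (εA : A →ₗ[K] K) (ΔB : B →ₗ[K] B ⊗[K] B)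
    (εB : B →ₗ[K] K) (φ : A →ₗ[K] B) : Prop where
  map_one : φ 1 = 1
  map_mul : ∀ x y, φ (x * y) = φ x * φ y
  map_comul : ∀ x, ΔB (φ x) = TensorProduct.map φ φ (ΔA x)
  map_counit : ∀ x, εB (φ x) = εA x

namespace Hqp

open FinQuasiPoset

variable {K : Type*} [Field K]

/-- `φ` is a Hopf algebra morphism from `(H_qp, m, Δ)` to `(K[X], m, Δ)`. -/
def IsHopfMorphism (φ : Hqp K →ₗ[K] K[X]) : Prop :=
  IsBialgebraMorphism (Delta K) (eps K) (PolyBialg.Delta K) (PolyBialg.eps K) φ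

/-- `φ` is a bialgebra morphism from `(H_qp, m, δ)` to `(K[X], m, δ)`. -/
def IsDeltaMorphism (φ : Hqp K →ₗ[K] K[X]) : Prop :=
  IsBialgebraMorphism (delta K) (eps' K) (PolyBialg.delta K) (PolyBialg.eps' K) φ

/-- `φ` is a Hopf algebra morphism, homogeneous for the graduation of `H_qp` by `cl`, which maps
every quasi-poset with exactly one class to `X`. -/
structure IsHomogeneousNormalized (φ : Hqp K →ₗ[K] K[X]) : Prop where
  isHopfMorphism : IsHopfMorphism φ
  homogeneous : ∀ P : FinQuasiPoset, ∃ c : K, φ (cls K P) = Polynomial.C c * Polynomial.X ^ P.cl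
  map_oneClass : ∀ n : ℕ, 1 ≤ n → φ (cls K (oneClass n)) = Polynomial.X

/-- The action `φ ← χ = (φ ⊗ χ) ∘ δ` of a character `χ` on a linear map `φ`. -/
noncomputable def act (φ : Hqp K →ₗ[K] K[X]) (χ : Hqp K →ₐ[K] K) : Hqp K →ₗ[K] K[X] :=
  (TensorProduct.rid K K[X]).toLinearMap ∘ₗ TensorProduct.map φ χ.toLinearMap ∘ₗ delta K

/-- The convolution `χ * ψ = (χ ⊗ ψ) ∘ δ` of two characters, as a linear form. -/
noncomputable def conv (χ ψ : Hqp K →ₐ[K] K) : Hqp K →ₗ[K] K :=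
  LinearMap.mul' K K ∘ₗ TensorProduct.map χ.toLinearMap ψ.toLinearMap ∘ₗ delta K

end Hqp

namespace FinQuasiPoset

/-! The two coproducts mirror addition and multiplication of chain lengths. A strict map into the
ordinal sum of chains with `k` and `l` elements is an upper set `O` (the preimage of the upper
chain) together with strict maps on `O` and on its complement. A strict map into their lexicographic
product is a compatible `r` (the components of the fibres of the first coordinate) together with
strict maps on `P / r` and on `P | r`. These are `card_strictHom_sumLex` and
`card_strictHom_prodLex`. Evaluations at pairs of natural numbers separate `K[X] ⊗ K[X]` in
characteristic zero, so `ehrStr` respects both coproducts. It is the only such map: Δ determines a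
Hopf morphism from its values at `1`, and the counit of δ prescribes these values.

The second half is read off from coefficients. The strict Ehrhart polynomial lives in degrees
between `cc P` and `cl P`; λ is its coefficient of degree `cl P` and α that of degree `cc P`. As Δ
is graded by `cl`, the part of degree `cl P` is again a Hopf morphism, φ₀, and a Hopf morphism is
determined by its linear coefficients.

The coefficient of `X^i ⊗ X^j` in the δ-compatibility of `ehrStr` gives `[i = j] coeff_i(P) = ∑_r
coeff_i(P / r) coeff_j(P | r)`. For compatible `r`, both `cl (P / r)` and `cc (P | r)` are the
number of classes of `r`, while `cc (P / r) = cc P` and `cl (P | r) = cl P`. If `i = j`, only the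
`r` with `i` classes survive, with terms λ(P / r) α(P | r): this is `ehrStr = φ₀ ← α`. If `i = cc P`
and `j = cl P`, the identity is α * λ = ε', because `cc P = cl P` exactly for discrete `P`.
Evaluating `ehrStr = φ₀ ← α` at `1` gives λ * α = ε'. Finally α is unique since the coefficient of
degree `cc P` of `φ₀ ← β` at `P` is β(P). -/

instance (P : FinQuasiPoset) : Finite (Setoid P) :=
  Finite.of_injective (fun r : Setoid P => (r : P → P → Prop)) fun _ _ h =>
    Setoid.ext fun x y => iff_of_eq (congrFun (congrFun h x) y)

/-! ### Connected components -/

/-- The equivalence relation generated by the quasi-order of `P`: its classes are the connected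
components of `P`. -/
def connSetoid (P : FinQuasiPoset) : Setoid P := Relation.EqvGen.setoid (· ≤ ·)

/-- The number of connected components. -/
noncomputable def cc (P : FinQuasiPoset) : ℕ := Nat.card (Quotient P.connSetoid)

theorem connSetoid_of_le {P : FinQuasiPoset} {x y : P} (h : x ≤ y) : P.connSetoid x y :=
  Relation.EqvGen.rel _ _ h

/-- Universal property of the generated equivalence; it replaces induction on zigzags in most later
arguments. -/
theorem connSetoid_le_iff {P : FinQuasiPoset} {r : Setoid P} :
    P.connSetoid ≤ r ↔ ∀ x y : P, x ≤ y → r x y := by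
  refine ⟨fun h x y hxy => h (connSetoid_of_le hxy), fun h x y hxy => ?_⟩
  induction hxy with
  | rel x y hxy => exact h x y hxy
  | refl x => exact r.refl x
  | symm x y _ ih => exact r.symm ih
  | trans x y z _ _ ih₁ ih₂ => exact r.trans ih₁ ih₂

/-- In the upper-set topology, clopen means closed under `≤` in both directions, so the clopen sets
are the unions of components. -/
theorem isConnected_iff (P : FinQuasiPoset) :
    P.IsConnected ↔ Nonempty P ∧ ∀ x y, P.connSetoid x y := by
  let _ : TopologicalSpace P := Topology.upperSet P
  have hT : Topology.IsUpperSet P := ⟨rfl⟩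
  have hclopen : ∀ s : Set P, IsClopen s ↔ ∀ x y, x ≤ y → (x ∈ s ↔ y ∈ s) := by
    intro s
    rw [IsClopen, Topology.IsUpperSet.isOpen_iff_isUpperSet,
      Topology.IsUpperSet.isClosed_iff_isLower]
    exact ⟨fun h x y hxy => ⟨h.2 hxy, h.1 hxy⟩,
      fun h => ⟨fun x y hxy => (h y x hxy).2, fun x y hxy => (h x y hxy).1⟩⟩
  constructor
  · intro h
    have hc : ConnectedSpace P := h
    refine ⟨hc.toNonempty, fun x y => ?_⟩
    have := preconnectedSpace_iff_clopen.1 hc.toPreconnectedSpace {z | P.connSetoid x z}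
      ((hclopen _).2 fun a b hab => ⟨fun h => P.connSetoid.trans h (connSetoid_of_le hab),
        fun h => P.connSetoid.trans h (P.connSetoid.symm (connSetoid_of_le hab))⟩)
    rcases this with h | h
    · exact absurd (h ▸ P.connSetoid.refl x : x ∈ (∅ : Set P)) (Set.notMem_empty x)
    · exact (h ▸ Set.mem_univ y : y ∈ {z | P.connSetoid x z})
  · rintro ⟨hne, h⟩
    have : PreconnectedSpace P := preconnectedSpace_iff_clopen.2 fun s hs => by
      rw [hclopen] at hs
      -- Pulling back equality of propositions along membership: being in `s` is constant on
      -- components.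
      have key : P.connSetoid ≤ Setoid.comap (· ∈ s) ⊥ :=
        connSetoid_le_iff.2 fun x y hxy => propext (hs x y hxy)
      rcases s.eq_empty_or_nonempty with hs' | ⟨x, hx⟩
      · exact Or.inl hs'
      · exact Or.inr (Set.eq_univ_of_forall fun y =>
          cast (key (h x y) : (x ∈ s) = (y ∈ s)) hx)
    exact ⟨hne⟩

theorem isConnected_iff_cc (P : FinQuasiPoset) : P.IsConnected ↔ P.cc = 1 := by
  rw [isConnected_iff, cc, Nat.card_eq_one_iff_unique]
  constructor
  · rintro ⟨⟨x⟩, h⟩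
    exact ⟨⟨by rintro ⟨a⟩ ⟨b⟩; exact Quotient.sound (h a b)⟩, ⟨Quotient.mk _ x⟩⟩
  · rintro ⟨⟨h⟩, ⟨⟨x⟩⟩⟩
    exact ⟨⟨x⟩, fun a b => Quotient.exact (h (Quotient.mk _ a) (Quotient.mk _ b))⟩

/-! ### Counting classes -/

/-- The equivalence relation associated with the quasi-order of `P`. -/
def antisymmSetoid (P : FinQuasiPoset) : Setoid P := AntisymmRel.setoid P (· ≤ ·)

theorem cl_eq_card (P : FinQuasiPoset) : P.cl = Nat.card (Quotient P.antisymmSetoid) := rfl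

theorem card_quotient_congr {A B : Type*} (e : A ≃ B) (r : Setoid A) (s : Setoid B)
    (h : ∀ x y, r x y ↔ s (e x) (e y)) : Nat.card (Quotient r) = Nat.card (Quotient s) :=
  Nat.card_congr (Quotient.congr e h)

theorem card_quotient_add {A B C : Type*} [Finite C] (f : A → C) (g : B → C) (r : Setoid A)
    (s : Setoid B) (t : Setoid C) (hf : ∀ x y, t (f x) (f y) ↔ r x y)
    (hg : ∀ x y, t (g x) (g y) ↔ s x y) (hfg : ∀ x y, ¬ t (f x) (g y))
    (hsurj : ∀ z, (∃ x, f x = z) ∨ ∃ y, g y = z) :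
    Nat.card (Quotient t) = Nat.card (Quotient r) + Nat.card (Quotient s) := by
  let F : Quotient r → Quotient t := Quotient.map f fun x y h => (hf x y).2 h
  let G : Quotient s → Quotient t := Quotient.map g fun x y h => (hg x y).2 h
  have hF : Function.Injective F := by
    rintro ⟨x⟩ ⟨y⟩ h
    exact Quotient.sound ((hf x y).1 (Quotient.exact h))
  have hG : Function.Injective G := by
    rintro ⟨x⟩ ⟨y⟩ h
    exact Quotient.sound ((hg x y).1 (Quotient.exact h))
  have := Finite.of_injective F hF
  have := Finite.of_injective G hG
  rw [← Nat.card_sum]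
  refine (Nat.card_congr (Equiv.ofBijective (Sum.elim F G) ⟨hF.sumElim hG ?_, ?_⟩)).symm
  · rintro ⟨x⟩ ⟨y⟩ h
    exact hfg x y (Quotient.exact h)
  · rintro ⟨z⟩
    rcases hsurj z with ⟨x, rfl⟩ | ⟨y, rfl⟩
    · exact ⟨Sum.inl (Quotient.mk _ x), rfl⟩
    · exact ⟨Sum.inr (Quotient.mk _ y), rfl⟩

theorem connSetoid_map {P Q : FinQuasiPoset} {f : P → Q} (hf : Monotone f) {x y : P}
    (h : P.connSetoid x y) : Q.connSetoid (f x) (f y) :=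
  (connSetoid_le_iff.2 fun _ _ hxy => connSetoid_of_le (hf hxy) :
    P.connSetoid ≤ Q.connSetoid.comap f) h

theorem cl_congr {P Q : FinQuasiPoset} (h : P ≈ Q) : P.cl = Q.cl := by
  obtain ⟨e⟩ := h
  exact card_quotient_congr e.toEquiv P.antisymmSetoid Q.antisymmSetoid fun x y =>
    and_congr e.le_iff_le.symm e.le_iff_le.symm

theorem cc_congr {P Q : FinQuasiPoset} (h : P ≈ Q) : P.cc = Q.cc := by
  obtain ⟨e⟩ := h
  refine card_quotient_congr e.toEquiv _ _ fun x y => ⟨connSetoid_map e.monotone, fun h => ?_⟩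
  simpa using connSetoid_map e.symm.monotone h

theorem cl_empty : empty.cl = 0 := by
  have : IsEmpty (Quotient empty.antisymmSetoid) := ⟨by rintro ⟨x⟩; exact x.elim⟩
  rw [cl_eq_card, Nat.card_of_isEmpty]

theorem cc_empty : empty.cc = 0 := by
  have : IsEmpty (Quotient empty.connSetoid) := ⟨by rintro ⟨x⟩; exact x.elim⟩
  exact Nat.card_of_isEmpty

theorem cl_disjUnion (P Q : FinQuasiPoset) : (P.disjUnion Q).cl = P.cl + Q.cl :=
  card_quotient_add (C := P.disjUnion Q) (Sum.inl : P → P ⊕ Q) (Sum.inr : Q → P ⊕ Q)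
    P.antisymmSetoid Q.antisymmSetoid (P.disjUnion Q).antisymmSetoid
    (fun _ _ => and_congr Sum.inl_le_inl_iff Sum.inl_le_inl_iff)
    (fun _ _ => and_congr Sum.inr_le_inr_iff Sum.inr_le_inr_iff)
    (fun _ _ h => Sum.not_inl_le_inr h.1)
    (by rintro (x | y); exacts [Or.inl ⟨x, rfl⟩, Or.inr ⟨y, rfl⟩])

theorem connSetoid_disjUnion {P Q : FinQuasiPoset} {x y : P ⊕ Q}
    (h : (P.disjUnion Q).connSetoid x y) : Sum.LiftRel P.connSetoid Q.connSetoid x y := by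
  induction h with
  | rel x y h =>
    exact Sum.LiftRel.mono (fun _ _ => connSetoid_of_le) (fun _ _ => connSetoid_of_le) h
  | refl x => rcases x with x | x <;> constructor <;> exact Setoid.refl' _ x
  | symm x y _ ih => rcases ih with h | h <;> constructor <;> exact Setoid.symm' _ h
  | trans x y z _ _ ih₁ ih₂ =>
    rcases ih₁ with h | h <;> rcases ih₂ with h' | h' <;> constructor <;> exact Setoid.trans' _ h h'

theorem cc_disjUnion (P Q : FinQuasiPoset) : (P.disjUnion Q).cc = P.cc + Q.cc :=
  card_quotient_add (C := P.disjUnion Q) (Sum.inl : P → P ⊕ Q) (Sum.inr : Q → P ⊕ Q)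
    P.connSetoid Q.connSetoid (P.disjUnion Q).connSetoid
    (fun _ _ => ⟨fun h => Sum.liftRel_inl_inl.1 (connSetoid_disjUnion h),
      connSetoid_map (Q := P.disjUnion Q) Sum.inl_mono⟩)
    (fun _ _ => ⟨fun h => Sum.liftRel_inr_inr.1 (connSetoid_disjUnion h),
      connSetoid_map (Q := P.disjUnion Q) Sum.inr_mono⟩)
    (fun _ _ h => Sum.not_liftRel_inl_inr (connSetoid_disjUnion h))
    (by rintro (x | y); exacts [Or.inl ⟨x, rfl⟩, Or.inr ⟨y, rfl⟩])

/-- No class of the quasi-order meets both an upper set and its complement, so Δ is graded by `cl`.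
-/
theorem cl_restrict_add (P : FinQuasiPoset) (O : UpperSet P) :
    (P.restrict {x | x ∉ O}).cl + (P.restrict {x | x ∈ O}).cl = P.cl := by
  refine (card_quotient_add (Subtype.val : {x | x ∉ O} → P) (Subtype.val : {x | x ∈ O} → P)
    (P.restrict {x | x ∉ O}).antisymmSetoid (P.restrict {x | x ∈ O}).antisymmSetoid
    P.antisymmSetoid (fun _ _ => Iff.rfl) (fun _ _ => Iff.rfl)
    (fun x y h => x.2 (O.upper h.2 y.2)) fun z => ?_).symm
  by_cases hz : z ∈ O
  · exact Or.inr ⟨⟨z, hz⟩, rfl⟩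
  · exact Or.inl ⟨⟨z, hz⟩, rfl⟩

theorem cl_pos (P : FinQuasiPoset) [Nonempty P] : 0 < P.cl :=
  have : Nonempty (Quotient P.antisymmSetoid) := ‹Nonempty P›.map (Quotient.mk _)
  have : Finite (Quotient P.antisymmSetoid) := Quotient.finite _
  Nat.card_pos (α := Quotient P.antisymmSetoid)

theorem equiv_empty (P : FinQuasiPoset) [IsEmpty P] : P ≈ empty :=
  ⟨⟨Equiv.equivOfIsEmpty P Empty, fun {x} => isEmptyElim x⟩⟩

theorem exists_equiv_oneClass (P : FinQuasiPoset) (h : P.cl = 1) :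
    ∃ n, 1 ≤ n ∧ P ≈ oneClass n := by
  obtain ⟨⟨hs⟩, ⟨x⟩⟩ := Nat.card_eq_one_iff_unique.1 h
  obtain ⟨x⟩ := x
  have : Nonempty P := ⟨x⟩
  refine ⟨Nat.card P, Nat.card_pos, ⟨⟨Finite.equivFin P, fun {a b} => ?_⟩⟩⟩
  exact iff_of_true trivial
    ((Quotient.exact (hs (Quotient.mk P.antisymmSetoid a) (Quotient.mk P.antisymmSetoid b))).1)

/-- A quasi-poset which is neither empty nor connected is a disjoint union of smaller ones. -/
theorem exists_disjUnion (P : FinQuasiPoset) [Nonempty P] (h : ¬ P.IsConnected) :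
    ∃ Q R : FinQuasiPoset, P ≈ Q.disjUnion R ∧ Nat.card Q < Nat.card P ∧
      Nat.card R < Nat.card P := by
  classical
  have : ∃ x y, ¬ P.connSetoid x y := by
    by_contra! h'
    exact h ((isConnected_iff P).2 ⟨‹_›, h'⟩)
  obtain ⟨x, y, hxy⟩ := this
  let s : Set P := {z | P.connSetoid x z}
  have hs : ∀ a b, a ≤ b → (a ∈ s ↔ b ∈ s) := fun a b hab =>
    ⟨fun h => P.connSetoid.trans h (connSetoid_of_le hab),
      fun h => P.connSetoid.trans h (P.connSetoid.symm (connSetoid_of_le hab))⟩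
  refine ⟨P.restrict s, P.restrict sᶜ, ⟨OrderIso.symm ⟨Equiv.Set.sumCompl s, ?_⟩⟩, ?_, ?_⟩
  · rintro (⟨a, ha⟩ | ⟨a, ha⟩) (⟨b, hb⟩ | ⟨b, hb⟩)
    · exact ⟨fun h => Sum.LiftRel.inl (r := fun a b : P.restrict s => a ≤ b)
        (s := fun a b : P.restrict sᶜ => a ≤ b) h, Sum.liftRel_inl_inl.1⟩
    · exact iff_of_false (fun h => hb ((hs a b h).1 ha)) Sum.not_liftRel_inl_inr
    · exact iff_of_false (fun h => ha ((hs a b h).2 hb)) Sum.not_liftRel_inr_inl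
    · exact ⟨fun h => Sum.LiftRel.inr (r := fun a b : P.restrict s => a ≤ b)
        (s := fun a b : P.restrict sᶜ => a ≤ b) h, Sum.liftRel_inr_inr.1⟩
  · exact Finite.card_subtype_lt (x := y) hxy
  · exact Finite.card_subtype_lt (x := x) fun h => h (P.connSetoid.refl x)

/-! ### Compatible equivalence relations -/

theorem contractLE_of_le {P : FinQuasiPoset} {r : Setoid P} {x y : P} (h : x ≤ y) :
    P.contractLE r x y := Relation.TransGen.single (Or.inl h)

theorem contractLE_of_rel {P : FinQuasiPoset} {r : Setoid P} {x y : P} (h : r x y) :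
    P.contractLE r x y := Relation.TransGen.single (Or.inr h)

/-- A zigzag of `P | r` never leaves its class, hence is a zigzag of the restriction of `P` to that
class. This serves to verify the field `connected`. -/
theorem isConnected_class {P : FinQuasiPoset} {r : Setoid P}
    (h : ∀ x y, r x y → (P.restrictRel r).connSetoid x y) (x : P) :
    (P.restrict {y | r x y}).IsConnected := by
  have hle : ∀ a b, (P.restrictRel r).connSetoid a b → r a b := fun a b hab =>
    (connSetoid_le_iff.2 fun a b hab => hab.2 : (P.restrictRel r).connSetoid ≤ r) hab
  have key : ∀ a b, (P.restrictRel r).connSetoid a b → ∀ (ha : r x a) (hb : r x b),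
      (P.restrict {y | r x y}).connSetoid ⟨a, ha⟩ ⟨b, hb⟩ := by
    intro a b hab
    induction hab with
    | rel a b hab => exact fun ha hb => connSetoid_of_le hab.1
    | refl a => exact fun ha _ => Setoid.refl' _ _
    | symm a b _ ih => exact fun ha hb => Setoid.symm' _ (ih hb ha)
    | trans a b c hab _ ih₁ ih₂ =>
      exact fun ha hc =>
        have hb := r.trans ha (hle a b hab)
        Setoid.trans' _ (ih₁ ha hb) (ih₂ hb hc)
  refine (isConnected_iff _).2 ⟨⟨⟨x, r.refl x⟩⟩, fun ⟨a, ha⟩ ⟨b, hb⟩ => ?_⟩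
  exact key a b (h a b (r.trans (r.symm ha) hb)) ha hb

/-- Together with `antisymmSetoid_contract`: a compatible `r` is both the component relation of `P |
r` and the equivalence of the quasi-order of `P / r`, whence the counts `cc (P | r)` and `cl (P /
r)`. -/
theorem Compatible.connSetoid_restrictRel {P : FinQuasiPoset} {r : Setoid P}
    (h : P.Compatible r) : (P.restrictRel r).connSetoid = r := by
  refine le_antisymm (connSetoid_le_iff.2 fun a b hab => hab.2) fun x y hxy => ?_
  have h' := ((isConnected_iff _).1 (h.connected x)).2 ⟨x, r.refl x⟩ ⟨y, hxy⟩
  exact connSetoid_map (Q := P.restrictRel r)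
    (f := fun z : P.restrict {y | r x y} => (z : {y | r x y}).1)
    (fun a b hab => ⟨hab, r.trans (r.symm a.2) b.2⟩) h'

theorem Compatible.antisymmSetoid_contract {P : FinQuasiPoset} {r : Setoid P}
    (h : P.Compatible r) : (P.contract r).antisymmSetoid = r :=
  Setoid.ext fun x y => ⟨fun hxy => h.equiv x y hxy.1 hxy.2,
    fun hxy => ⟨contractLE_of_rel hxy, contractLE_of_rel (r.symm hxy)⟩⟩

theorem Compatible.le_connSetoid {P : FinQuasiPoset} {r : Setoid P}
    (h : P.Compatible r) : r ≤ P.connSetoid := by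
  conv_lhs => rw [← h.connSetoid_restrictRel]
  exact connSetoid_le_iff.2 fun a b hab => connSetoid_of_le hab.1

theorem Compatible.connSetoid_contract {P : FinQuasiPoset} {r : Setoid P}
    (h : P.Compatible r) : (P.contract r).connSetoid = P.connSetoid := by
  refine le_antisymm (connSetoid_le_iff.2 fun a b hab => ?_)
    (connSetoid_le_iff.2 fun a b hab =>
      connSetoid_of_le (P := P.contract r) (contractLE_of_le hab))
  have hstep : ∀ a b, a ≤ b ∨ r a b → P.connSetoid a b := fun a b hab =>
    hab.elim connSetoid_of_le fun h' => h.le_connSetoid h'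
  have hab' : P.contractLE r a b := hab
  unfold contractLE at hab'
  induction hab' with
  | single h => exact hstep _ _ h
  | tail _ h ih => exact P.connSetoid.trans (ih ‹_›) (hstep _ _ h)

theorem Compatible.cl_contract {P : FinQuasiPoset} {r : Setoid P} (h : P.Compatible r) :
    (P.contract r).cl = Nat.card (Quotient r) := by
  conv_rhs => rw [← h.antisymmSetoid_contract]
  rfl

theorem Compatible.cc_restrictRel {P : FinQuasiPoset} {r : Setoid P} (h : P.Compatible r) :
    (P.restrictRel r).cc = Nat.card (Quotient r) := by
  conv_rhs => rw [← h.connSetoid_restrictRel]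
  rfl

theorem Compatible.cc_contract {P : FinQuasiPoset} {r : Setoid P} (h : P.Compatible r) :
    (P.contract r).cc = P.cc := by
  unfold cc
  rw [h.connSetoid_contract]
  rfl

/-- Elements equivalent in `P` are equivalent in `P / r`, hence related by `r`: passing to `P | r`
splits no class. -/
theorem Compatible.cl_restrictRel {P : FinQuasiPoset} {r : Setoid P} (h : P.Compatible r) :
    (P.restrictRel r).cl = P.cl := by
  refine card_quotient_congr (Equiv.refl P) (P.restrictRel r).antisymmSetoid P.antisymmSetoid
    fun x y => ⟨fun h' => ⟨h'.1.1, h'.2.1⟩, fun h' => ?_⟩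
  have hr := h.equiv x y (contractLE_of_le h'.1) (contractLE_of_le h'.2)
  exact ⟨⟨h'.1, hr⟩, ⟨h'.2, r.symm hr⟩⟩

theorem contractLE_connSetoid {P : FinQuasiPoset} {x y : P} (h : P.contractLE P.connSetoid x y) :
    P.connSetoid x y := by
  have hstep : ∀ a b, a ≤ b ∨ P.connSetoid a b → P.connSetoid a b := fun a b hab =>
    hab.elim connSetoid_of_le id
  unfold contractLE at h
  induction h with
  | single h => exact hstep _ _ h
  | tail _ h ih => exact P.connSetoid.trans ih (hstep _ _ h)

/-- By `Compatible.le_connSetoid` this is the coarsest compatible equivalence; it yields the term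
with discrete `P / r` and with `P | r` isomorphic to `P`. -/
theorem compatible_connSetoid (P : FinQuasiPoset) : P.Compatible P.connSetoid where
  connected := isConnected_class fun x y => by
    refine fun h => (connSetoid_le_iff.2 fun a b hab => ?_ :
      P.connSetoid ≤ (P.restrictRel P.connSetoid).connSetoid) h
    exact connSetoid_of_le (P := P.restrictRel P.connSetoid) ⟨hab, connSetoid_of_le hab⟩
  equiv _ _ h _ := contractLE_connSetoid h

theorem isDiscrete_contract_connSetoid (P : FinQuasiPoset) :
    (P.contract P.connSetoid).IsDiscrete :=
  fun _ _ h => contractLE_of_rel (P.connSetoid.symm (contractLE_connSetoid h))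

theorem restrictRel_connSetoid (P : FinQuasiPoset) : P.restrictRel P.connSetoid ≈ P :=
  ⟨⟨Equiv.refl P, fun {_ _} => ⟨fun h => ⟨h, connSetoid_of_le h⟩, fun h => h.1⟩⟩⟩

theorem eq_of_le_of_card_quotient {A : Type*} [Finite A] {r s : Setoid A} (h : r ≤ s)
    (hc : Nat.card (Quotient r) = Nat.card (Quotient s)) : r = s := by
  have : Finite (Quotient r) := Quotient.finite _
  have : Finite (Quotient s) := Quotient.finite _
  let F : Quotient r → Quotient s := Quotient.map id fun _ _ hxy => h hxy
  have hF : Function.Surjective F := by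
    rintro ⟨x⟩
    exact ⟨Quotient.mk _ x, rfl⟩
  have hF' := (Nat.bijective_iff_surjective_and_card F).2 ⟨hF, hc⟩
  refine le_antisymm h fun x y hxy => ?_
  exact Quotient.exact (hF'.1 (Quotient.sound hxy : F (Quotient.mk r x) = F (Quotient.mk r y)))

theorem antisymmSetoid_le_connSetoid (P : FinQuasiPoset) : P.antisymmSetoid ≤ P.connSetoid :=
  fun _ _ h => connSetoid_of_le h.1

/-- Turns ε' into a Kronecker delta in `cc` and `cl`, the shape in which coefficients of δ on `K[X]`
produce it. -/
theorem isDiscrete_iff_cc_eq_cl (P : FinQuasiPoset) : P.IsDiscrete ↔ P.cc = P.cl := by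
  constructor
  · intro h
    have : P.connSetoid = P.antisymmSetoid :=
      le_antisymm (connSetoid_le_iff.2 fun x y hxy => ⟨hxy, h x y hxy⟩)
        P.antisymmSetoid_le_connSetoid
    rw [cc, this, cl_eq_card]
  · intro h x y hxy
    have := eq_of_le_of_card_quotient P.antisymmSetoid_le_connSetoid (P.cl_eq_card ▸ h.symm)
    exact (this ▸ connSetoid_of_le hxy : P.antisymmSetoid x y).2

end FinQuasiPoset

namespace FinQuasiPoset

/-! ### Counting strict maps -/

/-- The strictly order-preserving maps from `P` to a partially ordered set `L`. -/
def StrictHom (P : FinQuasiPoset) (L : Type*) [PartialOrder L] :=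
  {f : P → L // (∀ x y, x ≤ y → f x ≤ f y) ∧ ∀ x y, x ≤ y → f x = f y → y ≤ x}

instance (P : FinQuasiPoset) (L : Type*) [PartialOrder L] [Finite L] : Finite (P.StrictHom L) :=
  inferInstanceAs (Finite (Subtype _))

theorem card_strictMaps_eq (P : FinQuasiPoset) (k : ℕ) :
    Nat.card (P.strictMaps k) = Nat.card (P.StrictHom (Fin k)) := rfl

theorem card_strictHom_congr (P : FinQuasiPoset) {L M : Type*} [PartialOrder L] [PartialOrder M]
    (e : L ≃o M) : Nat.card (P.StrictHom L) = Nat.card (P.StrictHom M) :=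
  Nat.card_congr <| (Equiv.arrowCongr (Equiv.refl P) e.toEquiv).subtypeEquiv fun f => by
    simp [Equiv.arrowCongr]

theorem card_strictMaps_of_card (P : FinQuasiPoset) (L : Type*) [LinearOrder L] [Finite L] (k : ℕ)
    (h : Nat.card L = k) : Nat.card (P.strictMaps k) = Nat.card (P.StrictHom L) := by
  let _ : Fintype L := Fintype.ofFinite L
  rw [card_strictMaps_eq]
  exact P.card_strictHom_congr (Fintype.orderIsoFinOfCardEq L (by rw [← Nat.card_eq_fintype_card, h]))

theorem card_strictHom_disjUnion (P Q : FinQuasiPoset) (L : Type*) [PartialOrder L] [Finite L] :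
    Nat.card ((P.disjUnion Q).StrictHom L) =
      Nat.card (P.StrictHom L) * Nat.card (Q.StrictHom L) := by
  rw [← Nat.card_prod]
  refine Nat.card_congr ⟨fun f => (⟨fun x => f.1 (Sum.inl x), ?_, ?_⟩,
    ⟨fun x => f.1 (Sum.inr x), ?_, ?_⟩), fun fg => ⟨Sum.elim fg.1.1 fg.2.1, ?_, ?_⟩, ?_, ?_⟩
  · exact fun x y h => f.2.1 _ _ (Sum.inl_le_inl_iff.2 h)
  · exact fun x y h h' => Sum.inl_le_inl_iff.1 (f.2.2 _ _ (Sum.inl_le_inl_iff.2 h) h')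
  · exact fun x y h => f.2.1 _ _ (Sum.inr_le_inr_iff.2 h)
  · exact fun x y h h' => Sum.inr_le_inr_iff.1 (f.2.2 _ _ (Sum.inr_le_inr_iff.2 h) h')
  · rintro (x | x) (y | y) h
    · exact fg.1.2.1 _ _ (Sum.inl_le_inl_iff.1 h)
    · exact absurd h Sum.not_inl_le_inr
    · exact absurd h Sum.not_inr_le_inl
    · exact fg.2.2.1 _ _ (Sum.inr_le_inr_iff.1 h)
  · rintro (x | x) (y | y) h h'
    · exact Sum.inl_le_inl_iff.2 (fg.1.2.2 _ _ (Sum.inl_le_inl_iff.1 h) h')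
    · exact absurd h Sum.not_inl_le_inr
    · exact absurd h Sum.not_inr_le_inl
    · exact Sum.inr_le_inr_iff.2 (fg.2.2.2 _ _ (Sum.inr_le_inr_iff.1 h) h')
  · intro f
    exact Subtype.ext (funext fun x => by rcases x with x | x <;> rfl)
  · intro fg
    rfl

/-- A strict map is cut along the preimage of the upper summand. Conversely any two strict maps
glue: comparable elements on different sides go from `L` up to `M`, with distinct values. -/
theorem card_strictHom_sumLex (P : FinQuasiPoset) (L M : Type*) [PartialOrder L] [PartialOrder M]
    [Finite L] [Finite M] :
    Nat.card (P.StrictHom (L ⊕ₗ M)) = ∑ᶠ O : UpperSet P,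
      Nat.card ((P.restrict {x | x ∉ O}).StrictHom L) *
        Nat.card ((P.restrict {x | x ∈ O}).StrictHom M) := by
  classical
  let _ : Fintype (UpperSet P) := Fintype.ofFinite _
  rw [finsum_eq_sum_of_fintype]
  simp_rw [← Nat.card_prod]
  rw [← Nat.card_sigma]
  let F : (Σ O : UpperSet P, (P.restrict {x | x ∉ O}).StrictHom L ×
      (P.restrict {x | x ∈ O}).StrictHom M) → P → L ⊕ₗ M := fun a x =>
    if h : x ∈ a.1 then Sum.inrₗ (a.2.2.1 ⟨x, h⟩) else Sum.inlₗ (a.2.1.1 ⟨x, h⟩)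
  have hpos : ∀ a x (h : x ∈ a.1), F a x = Sum.inrₗ (a.2.2.1 ⟨x, h⟩) := fun a x h => dif_pos h
  have hneg : ∀ a x (h : x ∈ {x | x ∉ a.1}), F a x = Sum.inlₗ (a.2.1.1 ⟨x, h⟩) :=
    fun a x h => dif_neg h
  have hF : ∀ a, (∀ x y, x ≤ y → F a x ≤ F a y) ∧ ∀ x y, x ≤ y → F a x = F a y → y ≤ x := by
    intro a
    constructor
    · intro x y hxy
      by_cases hx : x ∈ a.1
      · have hy := a.1.upper hxy hx
        rw [hpos a x hx, hpos a y hy]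
        exact Sum.Lex.inr_le_inr_iff.2 (a.2.2.2.1 _ _ hxy)
      · rw [hneg a x hx]
        by_cases hy : y ∈ a.1
        · rw [hpos a y hy]
          exact Sum.Lex.inl_le_inr _ _
        · rw [hneg a y hy]
          exact Sum.Lex.inl_le_inl_iff.2 (a.2.1.2.1 _ _ hxy)
    · intro x y hxy h
      by_cases hx : x ∈ a.1
      · have hy := a.1.upper hxy hx
        rw [hpos a x hx, hpos a y hy] at h
        exact a.2.2.2.2 ⟨x, hx⟩ ⟨y, hy⟩ hxy (Sum.inr_injective (toLex.injective h))
      · rw [hneg a x hx] at h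
        by_cases hy : y ∈ a.1
        · rw [hpos a y hy] at h
          exact absurd (toLex.injective h) Sum.inl_ne_inr
        · rw [hneg a y hy] at h
          exact a.2.1.2.2 ⟨x, hx⟩ ⟨y, hy⟩ hxy (Sum.inl_injective (toLex.injective h))
  refine (Nat.card_congr (Equiv.ofBijective (fun a => (⟨F a, hF a⟩ : P.StrictHom (L ⊕ₗ M)))
    ⟨?_, ?_⟩)).symm
  · intro a b hab
    have hab' : ∀ x, F a x = F b x := congrFun (congrArg Subtype.val hab)
    have hO : a.1 = b.1 := by
      ext x
      by_cases hx : x ∈ a.1 <;> by_cases hy : x ∈ b.1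
      · exact iff_of_true hx hy
      · have := hab' x
        rw [hpos a x hx, hneg b x hy] at this
        exact absurd (toLex.injective this) Sum.inr_ne_inl
      · have := hab' x
        rw [hneg a x hx, hpos b x hy] at this
        exact absurd (toLex.injective this) Sum.inl_ne_inr
      · exact iff_of_false hx hy
    obtain ⟨O, f, g⟩ := a
    obtain ⟨O', f', g'⟩ := b
    obtain rfl : O = O' := hO
    obtain rfl : f = f' := Subtype.ext <| funext fun ⟨x, hx⟩ => by
      have := hab' x
      rw [hneg ⟨O, f, g⟩ x hx, hneg ⟨O, f', g'⟩ x hx] at this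
      exact Sum.inl_injective (toLex.injective this)
    obtain rfl : g = g' := Subtype.ext <| funext fun ⟨x, hx⟩ => by
      have := hab' x
      rw [hpos _ x hx, hpos _ x hx] at this
      exact Sum.inr_injective (toLex.injective this)
    rfl
  · rintro ⟨f, hf, hf'⟩
    -- The preimage of the upper summand, an upper set because `f` is monotone.
    let O : UpperSet P := ⟨{x | ∃ m, f x = Sum.inrₗ m}, by
      rintro x y hxy ⟨m, hm⟩
      have h := hf x y hxy
      rw [hm] at h
      change ∃ m, f y = Sum.inrₗ m
      generalize f y = z at h
      rcases z with l | m'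
      · exact absurd h Sum.Lex.not_inr_le_inl
      · exact ⟨m', rfl⟩⟩
    have hO : ∀ x : P.restrict {x | x ∈ O}, ∃ m, f x.1 = Sum.inrₗ m := fun x => x.2
    have hO' : ∀ x : P.restrict {x | x ∉ O}, ∃ m, f x.1 = Sum.inlₗ m := by
      rintro ⟨x, hx⟩
      change ¬ ∃ m, f x = Sum.inrₗ m at hx
      change ∃ m, f x = Sum.inlₗ m
      generalize f x = z at hx
      rcases z with l | m'
      · exact ⟨l, rfl⟩
      · exact absurd ⟨m', rfl⟩ hx
    choose g hg using hO'
    choose h hh using hO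
    refine ⟨⟨O, ⟨g, fun x y hxy => ?_, fun x y hxy hxy' => ?_⟩,
      ⟨h, fun x y hxy => ?_, fun x y hxy hxy' => ?_⟩⟩, Subtype.ext (funext fun x => ?_)⟩
    · have := hf _ _ hxy
      rw [hg, hg] at this
      exact Sum.Lex.inl_le_inl_iff.1 this
    · exact hf' _ _ hxy (by rw [hg, hg, hxy'])
    · have := hf _ _ hxy
      rw [hh, hh] at this
      exact Sum.Lex.inr_le_inr_iff.1 this
    · exact hf' _ _ hxy (by rw [hh, hh, hxy'])
    · by_cases hx : x ∈ O
      · exact (dif_pos hx).trans (hh ⟨x, hx⟩).symm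
      · exact (dif_neg hx).trans (hg ⟨x, hx⟩).symm

/-- The connected components of the fibres of `g`. -/
def fibreSetoid (P : FinQuasiPoset) {L : Type*} (g : P → L) : Setoid P :=
  (P.restrictRel (Setoid.ker g)).connSetoid

theorem fibreSetoid_le_ker (P : FinQuasiPoset) {L : Type*} (g : P → L) :
    P.fibreSetoid g ≤ Setoid.ker g :=
  connSetoid_le_iff.2 fun _ _ h => h.2

theorem fibreSetoid_of_le {P : FinQuasiPoset} {L : Type*} {g : P → L} {x y : P} (h : x ≤ y)
    (h' : g x = g y) : P.fibreSetoid g x y :=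
  connSetoid_of_le (P := P.restrictRel (Setoid.ker g)) ⟨h, h'⟩

theorem le_of_contractLE {P : FinQuasiPoset} {L : Type*} [PartialOrder L] {g : P → L}
    {r : Setoid P} (hg : ∀ x y, x ≤ y → g x ≤ g y) (hr : r ≤ Setoid.ker g) {x y : P}
    (h : P.contractLE r x y) : g x ≤ g y := by
  have hstep : ∀ a b, a ≤ b ∨ r a b → g a ≤ g b := fun a b hab =>
    hab.elim (hg a b) fun h => le_of_eq (hr h)
  unfold contractLE at h
  induction h with
  | single h => exact hstep _ _ h
  | tail _ h ih => exact ih.trans (hstep _ _ h)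

/-- Along a chain of `P / r` the values of `g` do not decrease; equal values at the ends force `g`
to be constant, so every step stays inside a fibre. -/
theorem fibreSetoid_of_contractLE {P : FinQuasiPoset} {L : Type*} [PartialOrder L] {g : P → L}
    (hg : ∀ x y, x ≤ y → g x ≤ g y) {x y : P} (h : P.contractLE (P.fibreSetoid g) x y)
    (h' : g x = g y) : P.fibreSetoid g x y := by
  have hle : ∀ {x y}, P.contractLE (P.fibreSetoid g) x y → g x ≤ g y := fun h =>
    le_of_contractLE hg (P.fibreSetoid_le_ker g) h
  have h₀ := h
  unfold contractLE at h
  have hstep : ∀ a b, a ≤ b ∨ P.fibreSetoid g a b → g a = g b → P.fibreSetoid g a b :=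
    fun a b hab hab' => hab.elim (fun h => fibreSetoid_of_le h hab') id
  induction h with
  | single h => exact hstep _ _ h h'
  | @tail b c hab hbc ih =>
    have h₁ := hle hab
    have h₂ := hle (Relation.TransGen.single hbc)
    have h₃ : g x = g b := le_antisymm h₁ (h'.symm ▸ h₂)
    exact (P.fibreSetoid g).trans (ih h₃ hab) (hstep _ _ hbc (h₃.symm.trans h'))

theorem compatible_fibreSetoid {P : FinQuasiPoset} {L : Type*} [PartialOrder L] {g : P → L}
    (hg : ∀ x y, x ≤ y → g x ≤ g y) : P.Compatible (P.fibreSetoid g) where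
  connected := isConnected_class fun _ _ h =>
    (connSetoid_le_iff.2 fun _ _ hab =>
      connSetoid_of_le (P := P.restrictRel (P.fibreSetoid g))
        ⟨hab.1, fibreSetoid_of_le hab.1 hab.2⟩ :
      (P.restrictRel (Setoid.ker g)).connSetoid ≤ (P.restrictRel (P.fibreSetoid g)).connSetoid) h
  equiv _ _ h h' :=
    fibreSetoid_of_contractLE hg h (le_antisymm
      (le_of_contractLE hg (P.fibreSetoid_le_ker g) h)
      (le_of_contractLE hg (P.fibreSetoid_le_ker g) h'))

/-- A compatible equivalence is recovered from any strict map on the quotient. -/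
theorem Compatible.eq_fibreSetoid {P : FinQuasiPoset} {r : Setoid P} (hr : P.Compatible r)
    {L : Type*} [PartialOrder L] (g : (P.contract r).StrictHom L) : r = P.fibreSetoid g.1 := by
  have hker : ∀ x y, r x y → g.1 x = g.1 y := fun x y h =>
    le_antisymm (g.2.1 _ _ (contractLE_of_rel h)) (g.2.1 _ _ (contractLE_of_rel (r.symm h)))
  refine le_antisymm ?_ (connSetoid_le_iff.2 fun x y h => ?_)
  -- Classes of `r` are connected and `g` is constant on them; conversely, comparable elements of
  -- one fibre are equivalent in `P / r` by strictness, hence related by `r`.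
  · conv_lhs => rw [← hr.connSetoid_restrictRel]
    exact connSetoid_le_iff.2 fun x y h => fibreSetoid_of_le h.1 (hker _ _ h.2)
  · exact hr.equiv x y (contractLE_of_le h.1) (g.2.2 x y (contractLE_of_le h.1) h.2)

/-- The first coordinate `g` of a strict map is monotone only; contracting the components of its
fibres makes it strict, and the second coordinate is strict inside each component. Injectivity holds
because `r` is recovered from `g`. -/
theorem card_strictHom_prodLex (P : FinQuasiPoset) (L M : Type*) [PartialOrder L] [PartialOrder M]
    [Finite L] [Finite M] :
    Nat.card (P.StrictHom (L ×ₗ M)) = ∑ᶠ r : {r : Setoid P // P.Compatible r},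
      Nat.card ((P.contract r.1).StrictHom L) * Nat.card ((P.restrictRel r.1).StrictHom M) := by
  classical
  let _ : Fintype {r : Setoid P // P.Compatible r} := Fintype.ofFinite _
  rw [finsum_eq_sum_of_fintype]
  simp_rw [← Nat.card_prod]
  rw [← Nat.card_sigma]
  let F : (Σ r : {r : Setoid P // P.Compatible r}, (P.contract r.1).StrictHom L ×
      (P.restrictRel r.1).StrictHom M) → P → L ×ₗ M := fun a x => toLex (a.2.1.1 x, a.2.2.1 x)
  have hF : ∀ a, (∀ x y, x ≤ y → F a x ≤ F a y) ∧ ∀ x y, x ≤ y → F a x = F a y → y ≤ x := by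
    rintro ⟨⟨r, hr⟩, g, h⟩
    -- A tie in the first coordinate puts `x ≤ y` inside `P | r`, where `h` decides.
    have key : ∀ x y : P, x ≤ y → g.1 x = g.1 y → r x y := fun x y hxy hxy' =>
      hr.equiv x y (contractLE_of_le hxy) (g.2.2 x y (contractLE_of_le hxy) hxy')
    constructor
    · intro x y hxy
      refine Prod.Lex.toLex_le_toLex.2 ?_
      rcases (g.2.1 x y (contractLE_of_le hxy)).lt_or_eq with hlt | heq
      · exact Or.inl hlt
      · exact Or.inr ⟨heq, h.2.1 x y ⟨hxy, key x y hxy heq⟩⟩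
    · intro x y hxy hF
      have h₁ : g.1 x = g.1 y := congrArg (fun z => (ofLex z).1) hF
      have h₂ : h.1 x = h.1 y := congrArg (fun z => (ofLex z).2) hF
      exact (h.2.2 x y ⟨hxy, key x y hxy h₁⟩ h₂).1
  refine (Nat.card_congr (Equiv.ofBijective (fun a => (⟨F a, hF a⟩ : P.StrictHom (L ×ₗ M)))
    ⟨?_, ?_⟩)).symm
  · rintro ⟨⟨r, hr⟩, g, h⟩ ⟨⟨r', hr'⟩, g', h'⟩ hab
    have hab' : ∀ x, toLex (g.1 x, h.1 x) = toLex (g'.1 x, h'.1 x) :=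
      congrFun (congrArg Subtype.val hab)
    have hg : g.1 = g'.1 := funext fun x => congrArg (fun z => (ofLex z).1) (hab' x)
    have hh : h.1 = h'.1 := funext fun x => congrArg (fun z => (ofLex z).2) (hab' x)
    obtain rfl : r = r' := by
      rw [hr.eq_fibreSetoid g, hr'.eq_fibreSetoid g', hg]
    obtain rfl : g = g' := Subtype.ext hg
    obtain rfl : h = h' := Subtype.ext hh
    rfl
  · rintro ⟨f, hf, hf'⟩
    let g : P → L := fun x => (ofLex (f x)).1
    have hg : ∀ x y, x ≤ y → g x ≤ g y := fun x y hxy =>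
      (Prod.Lex.le_iff.1 (hf x y hxy)).elim le_of_lt fun h => le_of_eq h.1
    refine ⟨⟨⟨P.fibreSetoid g, compatible_fibreSetoid hg⟩,
      ⟨g, fun x y h => ?_, fun x y h h' => ?_⟩,
      ⟨fun x => (ofLex (f x)).2, fun x y h => ?_, fun x y h h' => ?_⟩⟩, rfl⟩
    · exact le_of_contractLE hg (P.fibreSetoid_le_ker g) h
    · exact contractLE_of_rel (Setoid.symm' _ (fibreSetoid_of_contractLE hg h h'))
    · exact (Prod.Lex.le_iff.1 (hf x y h.1)).elim
        (fun hlt => absurd (P.fibreSetoid_le_ker g h.2) hlt.ne) fun h => h.2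
    · refine ⟨hf' x y h.1 ?_, Setoid.symm' _ h.2⟩
      exact ofLex.injective (Prod.ext (P.fibreSetoid_le_ker g h.2) h')

/-! ### Functional equations and special values of the counts -/

theorem card_strictMaps_disjUnion (P Q : FinQuasiPoset) (k : ℕ) :
    Nat.card ((P.disjUnion Q).strictMaps k) =
      Nat.card (P.strictMaps k) * Nat.card (Q.strictMaps k) :=
  card_strictHom_disjUnion P Q (Fin k)

theorem card_strictMaps_add (P : FinQuasiPoset) (k l : ℕ) :
    Nat.card (P.strictMaps (k + l)) = ∑ᶠ O : UpperSet P,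
      Nat.card ((P.restrict {x | x ∉ O}).strictMaps k) *
        Nat.card ((P.restrict {x | x ∈ O}).strictMaps l) :=
  (P.card_strictMaps_of_card (Fin k ⊕ₗ Fin l) _
    ((Nat.card_congr ofLex).trans (by simp))).trans (P.card_strictHom_sumLex _ _)

theorem card_strictMaps_mul (P : FinQuasiPoset) (k l : ℕ) :
    Nat.card (P.strictMaps (k * l)) = ∑ᶠ r : {r : Setoid P // P.Compatible r},
      Nat.card ((P.contract r.1).strictMaps k) * Nat.card ((P.restrictRel r.1).strictMaps l) :=
  (P.card_strictMaps_of_card (Fin k ×ₗ Fin l) _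
    ((Nat.card_congr ofLex).trans (by simp))).trans (P.card_strictHom_prodLex _ _)

theorem card_strictMaps_of_isEmpty (P : FinQuasiPoset) [IsEmpty P] (k : ℕ) :
    Nat.card (P.strictMaps k) = 1 := by
  rw [card_strictMaps_eq, Nat.card_eq_one_iff_unique]
  exact ⟨⟨fun f g => Subtype.ext (Subsingleton.elim _ _)⟩,
    ⟨⟨isEmptyElim, fun x => isEmptyElim x, fun x => isEmptyElim x⟩⟩⟩

theorem card_strictMaps_zero (P : FinQuasiPoset) [h : Nonempty P] :
    Nat.card (P.strictMaps 0) = 0 := by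
  have : IsEmpty (P.strictMaps 0) := ⟨fun f => h.elim fun x => (f.1 x).elim0⟩
  exact Nat.card_of_isEmpty

theorem card_strictMaps_of_isDiscrete (P : FinQuasiPoset) (h : P.IsDiscrete) (k : ℕ) :
    Nat.card (P.strictMaps k) = k ^ P.cl := by
  have : Finite (Quotient P.antisymmSetoid) := Quotient.finite _
  have hcard : Nat.card (Quotient P.antisymmSetoid → Fin k) = k ^ P.cl := by
    rw [Nat.card_fun, Nat.card_fin]
    rfl
  rw [← hcard]
  refine Nat.card_congr ⟨fun f => Quotient.lift f.1 fun x y hxy =>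
    le_antisymm (f.2.1 x y hxy.1) (f.2.1 y x hxy.2), fun f => ⟨fun x => f (Quotient.mk _ x),
      fun x y hxy => le_of_eq (congrArg f (Quotient.sound ⟨hxy, h x y hxy⟩)),
      fun x y hxy _ => h x y hxy⟩, fun f => rfl, fun f => ?_⟩
  funext x
  rcases x with ⟨x⟩
  rfl

theorem card_strictMaps_one_of_not_isDiscrete (P : FinQuasiPoset) (h : ¬ P.IsDiscrete) :
    Nat.card (P.strictMaps 1) = 0 := by
  have : IsEmpty (P.strictMaps 1) :=
    ⟨fun f => h fun x y hxy => f.2.2 x y hxy (Subsingleton.elim _ _)⟩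
  exact Nat.card_of_isEmpty

/-- Strict maps factor through the poset of classes. This bounds the degree of the Ehrhart
polynomial by `cl P`. -/
theorem card_strictSurj_eq_zero_of_cl_lt (P : FinQuasiPoset) {i : ℕ} (h : P.cl < i) :
    Nat.card (P.strictSurj i) = 0 := by
  have : IsEmpty (P.strictSurj i) := ⟨fun f => by
    have : Finite (Quotient P.antisymmSetoid) := Quotient.finite _
    have hle := Nat.card_le_card_of_surjective
      (Quotient.lift f.1 fun x y hxy => le_antisymm (f.2.1.1 x y hxy.1) (f.2.1.1 y x hxy.2) :
        Quotient P.antisymmSetoid → Fin i)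
      fun j => (f.2.2 j).imp' (Quotient.mk _) fun x hx => hx
    rw [Nat.card_fin, ← cl_eq_card] at hle
    omega⟩
  exact Nat.card_of_isEmpty

theorem card_strictSurj_cl (P : FinQuasiPoset) : Nat.card (P.strictSurj P.cl) = P.mu := by
  have : Finite (Antisymmetrization P (· ≤ ·)) := Quotient.finite _
  let F : {f : Antisymmetrization P (· ≤ ·) ≃ Fin P.cl // Monotone f} → P.strictSurj P.cl :=
    fun f => ⟨fun x => f.1 (toAntisymmetrization (· ≤ ·) x),
      ⟨fun x y hxy => f.2 (toAntisymmetrization_le_toAntisymmetrization_iff.2 hxy),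
        fun x y _ h => (Quotient.exact (f.1.injective h) : AntisymmRel (· ≤ ·) x y).2⟩,
      f.1.surjective.comp Quotient.mk_surjective⟩
  refine (Nat.card_congr (Equiv.ofBijective F ⟨fun f g h => ?_, fun f => ?_⟩)).symm
  · refine Subtype.ext (Equiv.ext ?_)
    rintro ⟨x⟩
    exact congrFun (congrArg Subtype.val h) x
  · let f' : Antisymmetrization P (· ≤ ·) → Fin P.cl :=
      Quotient.lift f.1 fun x y hxy => le_antisymm (f.2.1.1 x y hxy.1) (f.2.1.1 y x hxy.2)
    have hf' : Function.Bijective f' := (Nat.bijective_iff_surjective_and_card f').2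
      ⟨fun j => (f.2.2 j).imp' (Quotient.mk _) fun x hx => hx, by rw [Nat.card_fin]; rfl⟩
    refine ⟨⟨Equiv.ofBijective f' hf', ?_⟩, rfl⟩
    rintro ⟨x⟩ ⟨y⟩ hxy
    exact f.2.1.1 x y hxy

end FinQuasiPoset

/-! ### Linear forms on tensor products -/

section Pairing

variable {K V W : Type*} [Field K] [AddCommGroup V] [Module K V] [AddCommGroup W] [Module K W]

/-- The linear form `f ⊗ g`. -/
noncomputable def pairing (f : V →ₗ[K] K) (g : W →ₗ[K] K) : V ⊗[K] W →ₗ[K] K :=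
  LinearMap.mul' K K ∘ₗ TensorProduct.map f g

@[simp]
theorem pairing_tmul (f : V →ₗ[K] K) (g : W →ₗ[K] K) (v : V) (w : W) :
    pairing f g (v ⊗ₜ w) = f v * g w := by
  simp [pairing]

/-- Products of separating families separate the tensor product: contracting `z` with `G j` gives a
vector killed by every `F i`, hence zero; then each coordinate of `z` along a basis of `V` is killed
by every `G j`, hence zero. -/
theorem eq_zero_of_pairing {ι κ : Type*} (F : ι → V →ₗ[K] K) (G : κ → W →ₗ[K] K)
    (hF : ∀ v, (∀ i, F i v = 0) → v = 0) (hG : ∀ w, (∀ j, G j w = 0) → w = 0) (z : V ⊗[K] W)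
    (h : ∀ i j, pairing (F i) (G j) z = 0) : z = 0 := by
  classical
  let b := Module.Basis.ofVectorSpace K V
  have h₁ : ∀ j, TensorProduct.rid K V (TensorProduct.map LinearMap.id (G j) z) = 0 := by
    refine fun j => hF _ fun i => ?_
    rw [← h i j]
    clear h
    induction z using TensorProduct.induction_on with
    | zero => simp
    | tmul v w => simp [mul_comm]
    | add x y hx hy => simp only [map_add, hx, hy]
  have h₂ : ∀ a, TensorProduct.lid K W (TensorProduct.map (b.coord a) LinearMap.id z) = 0 := by
    refine fun a => hG _ fun j => ?_
    have : b.coord a (TensorProduct.rid K V (TensorProduct.map LinearMap.id (G j) z)) = 0 := by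
      rw [h₁, map_zero]
    rw [← this]
    clear h₁ this h
    induction z using TensorProduct.induction_on with
    | zero => simp
    | tmul v w => simp [mul_comm]
    | add x y hx hy => simp only [map_add, hx, hy]
  refine (LinearEquiv.map_eq_zero_iff (TensorProduct.equivFinsuppOfBasisLeft b)).1 ?_
  ext a
  rw [Finsupp.zero_apply, ← h₂ a]
  clear h₁ h₂ h
  induction z using TensorProduct.induction_on with
  | zero => simp
  | tmul v w => simp
  | add x y hx hy => simp only [map_add, hx, hy, Finsupp.add_apply]

theorem eq_of_pairing {ι κ : Type*} (F : ι → V →ₗ[K] K) (G : κ → W →ₗ[K] K)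
    (hF : ∀ v, (∀ i, F i v = 0) → v = 0) (hG : ∀ w, (∀ j, G j w = 0) → w = 0) {z z' : V ⊗[K] W}
    (h : ∀ i j, pairing (F i) (G j) z = pairing (F i) (G j) z') : z = z' :=
  sub_eq_zero.1 <| eq_zero_of_pairing F G hF hG _ fun i j => by rw [map_sub, h, sub_self]

end Pairing

/-! ### Evaluations and coefficients on `K[X]`, paired with its coproducts -/

namespace PolyBialg

open Polynomial

variable {K : Type*} [Field K]

theorem eq_zero_of_lcoeff (p : K[X]) (h : ∀ i, lcoeff K i p = 0) : p = 0 :=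
  Polynomial.ext h

theorem eq_of_eval_natCast [CharZero K] {p q : K[X]} (h : ∀ k : ℕ, p.eval (k : K) = q.eval (k : K)) :
    p = q :=
  Polynomial.eq_of_infinite_eval_eq p q <|
    (Set.infinite_range_of_injective (Nat.cast_injective (R := K))).mono <| by
      rintro _ ⟨k, rfl⟩
      exact h k

theorem eq_zero_of_leval [CharZero K] (p : K[X]) (h : ∀ k : ℕ, leval (k : K) p = 0) : p = 0 :=
  eq_of_eval_natCast fun k => (h k).trans eval_zero.symm

theorem pairing_leval_Delta (x y : K) (p : K[X]) :
    pairing (leval x) (leval y) (Delta K p) = p.eval (x + y) := by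
  have : ((Algebra.TensorProduct.lmul' K).comp
      (Algebra.TensorProduct.map (aeval x : K[X] →ₐ[K] K) (aeval y))).comp
      (aeval ((X : K[X]) ⊗ₜ[K] (1 : K[X]) + (1 : K[X]) ⊗ₜ[K] (X : K[X]))) = aeval (x + y) := by
    ext; simp
  exact DFunLike.congr_fun this p

theorem pairing_leval_delta (x y : K) (p : K[X]) :
    pairing (leval x) (leval y) (delta K p) = p.eval (x * y) := by
  have : ((Algebra.TensorProduct.lmul' K).comp
      (Algebra.TensorProduct.map (aeval x : K[X] →ₐ[K] K) (aeval y))).comp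
      (aeval ((X : K[X]) ⊗ₜ[K] (X : K[X]))) = aeval (x * y) := by
    ext; simp
  exact DFunLike.congr_fun this p

theorem pairing_lcoeff_delta (i j : ℕ) (p : K[X]) :
    pairing (lcoeff K i) (lcoeff K j) (delta K p) = if i = j then p.coeff i else 0 := by
  induction p using Polynomial.induction_on' with
  | add p q hp hq => rw [map_add, map_add, hp, hq]; split_ifs <;> simp
  | monomial n a =>
    rw [← C_mul_X_pow_eq_monomial, ← smul_eq_C_mul, map_smul, map_smul]
    simp only [delta, AlgHom.toLinearMap_apply, map_pow, aeval_X, Algebra.TensorProduct.tmul_pow,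
      pairing_tmul, lcoeff_apply, coeff_X_pow, coeff_smul]
    split_ifs <;> simp_all

theorem pairing_lcoeff_Delta (i j : ℕ) (p : K[X]) :
    pairing (lcoeff K i) (lcoeff K j) (Delta K p) = (i + j).choose i * p.coeff (i + j) := by
  induction p using Polynomial.induction_on' with
  | add p q hp hq => rw [map_add, map_add, hp, hq, coeff_add, mul_add]
  | monomial n a =>
    rw [← C_mul_X_pow_eq_monomial, ← smul_eq_C_mul, map_smul, map_smul]
    simp only [Delta, AlgHom.toLinearMap_apply, map_pow, aeval_X, coeff_smul]
    rw [Commute.add_pow ((Commute.all _ _)), map_sum]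
    simp only [Algebra.TensorProduct.tmul_pow, one_pow, Algebra.TensorProduct.tmul_mul_tmul, mul_one,
      one_mul, ← nsmul_eq_mul', map_nsmul, pairing_tmul, lcoeff_apply, coeff_X_pow]
    by_cases hn : i + j = n
    · subst hn
      rw [Finset.sum_eq_single i]
      · simp [mul_comm]
      · intro k _ hk
        simp [hk.symm]
      · intro h
        exact absurd (Finset.mem_range.2 (by omega)) h
    · rw [if_neg hn, Finset.sum_eq_zero]
      · simp
      · intro k hk
        have := Finset.mem_range.1 hk
        by_cases hik : i = k
        · rw [if_neg (by omega : ¬ j = n - k)]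
          simp
        · simp [hik]

end PolyBialg

/-! ### Reduction of linear identities to isoclasses -/

namespace Hqp

open FinQuasiPoset

noncomputable instance (P : FinQuasiPoset) : Fintype (UpperSet P) := Fintype.ofFinite _

noncomputable instance (P : FinQuasiPoset) : Fintype {r : Setoid P // P.Compatible r} :=
  Fintype.ofFinite _

variable {K : Type*} [Field K]

theorem lhom_ext_cls {M : Type*} [AddCommGroup M] [Module K M] {φ ψ : Hqp K →ₗ[K] M}
    (h : ∀ P, φ (cls K P) = ψ (cls K P)) : φ = ψ := by
  refine MonoidAlgebra.lhom_ext' fun p => LinearMap.ext_ring ?_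
  obtain ⟨P⟩ := p
  exact h P

theorem cls_disjUnion (P Q : FinQuasiPoset) : cls K (P.disjUnion Q) = cls K P * cls K Q := by
  let p : QPClass := Quotient.mk _ P
  let q : QPClass := Quotient.mk _ Q
  have := MonoidAlgebra.single_mul_single p q (1 : K) 1
  rw [mul_one] at this
  exact this.symm

theorem map_mul_of_cls {B : Type*} [Ring B] [Algebra K B] (φ : Hqp K →ₗ[K] B)
    (h : ∀ P Q : FinQuasiPoset, φ (cls K (P.disjUnion Q)) = φ (cls K P) * φ (cls K Q))
    (x y : Hqp K) : φ (x * y) = φ x * φ y := by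
  have h₁ : ∀ P y, φ (cls K P * y) = φ (cls K P) * φ y := fun P => LinearMap.congr_fun <|
    lhom_ext_cls (φ := φ ∘ₗ LinearMap.mulLeft K (cls K P))
      (ψ := LinearMap.mulLeft K (φ (cls K P)) ∘ₗ φ) fun Q => by
        simp [← cls_disjUnion, h]
  exact LinearMap.congr_fun (lhom_ext_cls (φ := φ ∘ₗ LinearMap.mulRight K y)
    (ψ := LinearMap.mulRight K (φ y) ∘ₗ φ) fun P => by simp [h₁]) x

theorem Delta_cls (P : FinQuasiPoset) : Delta K (cls K P) =
    ∑ O : UpperSet P, cls K (P.restrict {x | x ∉ O}) ⊗ₜ[K] cls K (P.restrict {x | x ∈ O}) := by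
  rw [Delta, linLift_cls, DeltaFun, finsum_eq_sum_of_fintype]

theorem delta_cls (P : FinQuasiPoset) : delta K (cls K P) =
    ∑ r : {r : Setoid P // P.Compatible r},
      cls K (P.contract r.1) ⊗ₜ[K] cls K (P.restrictRel r.1) := by
  rw [delta, linLift_cls, deltaFun, finsum_eq_sum_of_fintype]

open Classical in
theorem eps_cls (P : FinQuasiPoset) : eps K (cls K P) = if IsEmpty P then 1 else 0 :=
  linLift_cls _ _ _ _

open Classical in
theorem eps'_cls (P : FinQuasiPoset) : eps' K (cls K P) = if P.IsDiscrete then 1 else 0 :=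
  linLift_cls _ _ _ _

theorem ehrStr_cls (P : FinQuasiPoset) : ehrStr K (cls K P) = P.ehrStrPoly K :=
  linLift_cls _ _ _ _

end Hqp

/-! ### Degree, valuation and extreme coefficients of the strict Ehrhart polynomial -/

namespace FinQuasiPoset

open Polynomial

variable (K : Type*) [Field K]

theorem coeff_hilbertPoly_of_lt {i n : ℕ} (h : i < n) : (hilbertPoly K i).coeff n = 0 := by
  rw [hilbertPoly, coeff_C_mul, coeff_eq_zero_of_natDegree_lt, mul_zero]
  rwa [descPochhammer_natDegree]

theorem coeff_hilbertPoly_self (n : ℕ) : (hilbertPoly K n).coeff n = (n.factorial : K)⁻¹ := by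
  have := (monic_descPochhammer K n).coeff_natDegree
  rw [descPochhammer_natDegree] at this
  rw [hilbertPoly, coeff_C_mul, this, mul_one]

theorem coeff_ehrStrPoly_of_cl_lt (P : FinQuasiPoset) {n : ℕ} (h : P.cl < n) :
    (P.ehrStrPoly K).coeff n = 0 := by
  rw [ehrStrPoly, finsetSum_coeff]
  refine Finset.sum_eq_zero fun i _ => ?_
  rw [coeff_natCast_mul]
  by_cases hi : i < n
  · rw [coeff_hilbertPoly_of_lt K hi, mul_zero]
  · rw [card_strictSurj_eq_zero_of_cl_lt P (by omega), Nat.cast_zero, zero_mul]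

theorem cl_le_card (P : FinQuasiPoset) : P.cl ≤ Nat.card P :=
  Nat.card_le_card_of_surjective (Quotient.mk P.antisymmSetoid) Quotient.mk_surjective

/-- Terms with `i < cl P` have too small a degree, those with `i > cl P` have no surjections;
surjective strict maps onto `cl P` elements are the heap-orderings. -/
theorem coeff_ehrStrPoly_cl (P : FinQuasiPoset) :
    (P.ehrStrPoly K).coeff P.cl = (P.mu : K) / (P.cl.factorial : K) := by
  rw [ehrStrPoly, finsetSum_coeff, Finset.sum_eq_single P.cl]
  · rw [coeff_natCast_mul, coeff_hilbertPoly_self, card_strictSurj_cl, div_eq_mul_inv]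
  · intro i _ hi
    rw [coeff_natCast_mul]
    rcases lt_or_gt_of_ne hi with hi | hi
    · rw [coeff_hilbertPoly_of_lt K hi, mul_zero]
    · rw [card_strictSurj_eq_zero_of_cl_lt P hi, Nat.cast_zero, zero_mul]
  · intro h
    exact absurd (Finset.mem_range.2 (Nat.lt_succ_of_le P.cl_le_card)) h

/-- The coefficient of degree `cl P` of the strict Ehrhart polynomial. -/
noncomputable def topCoeff (P : FinQuasiPoset) : K := (P.ehrStrPoly K).coeff P.cl

/-- The coefficient of degree `cc P` of the strict Ehrhart polynomial. -/
noncomputable def lowCoeff (P : FinQuasiPoset) : K := (P.ehrStrPoly K).coeff P.cc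

theorem topCoeff_congr {P Q : FinQuasiPoset} (h : P ≈ Q) : P.topCoeff K = Q.topCoeff K := by
  rw [topCoeff, topCoeff, ehrStrPoly_congr K h, cl_congr h]

theorem lowCoeff_congr {P Q : FinQuasiPoset} (h : P ≈ Q) : P.lowCoeff K = Q.lowCoeff K := by
  rw [lowCoeff, lowCoeff, ehrStrPoly_congr K h, cc_congr h]

variable [CharZero K]

theorem ehrStrPoly_disjUnion (P Q : FinQuasiPoset) :
    (P.disjUnion Q).ehrStrPoly K = P.ehrStrPoly K * Q.ehrStrPoly K :=
  PolyBialg.eq_of_eval_natCast fun k => by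
    simp only [eval_mul, eval_ehrStrPoly, card_strictMaps_disjUnion, Nat.cast_mul]

theorem ehrStrPoly_of_isEmpty (P : FinQuasiPoset) [IsEmpty P] : P.ehrStrPoly K = 1 :=
  PolyBialg.eq_of_eval_natCast fun k => by
    rw [eval_ehrStrPoly, card_strictMaps_of_isEmpty, Nat.cast_one, eval_one]

theorem ehrStrPoly_of_isDiscrete (P : FinQuasiPoset) (h : P.IsDiscrete) :
    P.ehrStrPoly K = X ^ P.cl :=
  PolyBialg.eq_of_eval_natCast fun k => by
    rw [eval_ehrStrPoly, card_strictMaps_of_isDiscrete P h, Nat.cast_pow, eval_pow, eval_X]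

open Classical in
theorem eval_zero_ehrStrPoly (P : FinQuasiPoset) :
    (P.ehrStrPoly K).eval 0 = if IsEmpty P then 1 else 0 := by
  split_ifs with h
  · rw [ehrStrPoly_of_isEmpty, eval_one]
  · have := not_isEmpty_iff.1 h
    have h' := eval_ehrStrPoly K P 0
    rwa [card_strictMaps_zero, Nat.cast_zero] at h'

open Classical in
theorem eval_one_ehrStrPoly (P : FinQuasiPoset) :
    (P.ehrStrPoly K).eval 1 = if P.IsDiscrete then 1 else 0 := by
  split_ifs with h
  · rw [ehrStrPoly_of_isDiscrete K P h, eval_pow, eval_X, one_pow]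
  · have h' := eval_ehrStrPoly K P 1
    rwa [card_strictMaps_one_of_not_isDiscrete P h, Nat.cast_zero, Nat.cast_one] at h'

/-- Each component contributes a factor `X`, since a non-empty quasi-poset has no map to the empty
chain. -/
theorem X_pow_cc_dvd_ehrStrPoly (P : FinQuasiPoset) : X ^ P.cc ∣ P.ehrStrPoly K := by
  by_cases hP : IsEmpty P
  · rw [cc_congr P.equiv_empty, cc_empty, pow_zero]
    exact one_dvd _
  by_cases hc : P.IsConnected
  · rw [(isConnected_iff_cc P).1 hc, pow_one, X_dvd_iff, coeff_zero_eq_eval_zero,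
      eval_zero_ehrStrPoly, if_neg hP]
  · have := not_isEmpty_iff.1 hP
    obtain ⟨Q, R, h, hQ, hR⟩ := P.exists_disjUnion hc
    rw [cc_congr h, ehrStrPoly_congr K h, cc_disjUnion, ehrStrPoly_disjUnion, pow_add]
    exact mul_dvd_mul (X_pow_cc_dvd_ehrStrPoly Q) (X_pow_cc_dvd_ehrStrPoly R)
  termination_by Nat.card P

theorem coeff_ehrStrPoly_of_lt_cc (P : FinQuasiPoset) {n : ℕ} (h : n < P.cc) :
    (P.ehrStrPoly K).coeff n = 0 :=
  X_pow_dvd_iff.1 (X_pow_cc_dvd_ehrStrPoly K P) n h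

theorem topCoeff_disjUnion (P Q : FinQuasiPoset) :
    (P.disjUnion Q).topCoeff K = P.topCoeff K * Q.topCoeff K := by
  rw [topCoeff, cl_disjUnion, ehrStrPoly_disjUnion]
  exact coeff_mul_add_eq_of_natDegree_le
    (natDegree_le_iff_coeff_eq_zero.2 fun _ => coeff_ehrStrPoly_of_cl_lt K P)
    (natDegree_le_iff_coeff_eq_zero.2 fun _ => coeff_ehrStrPoly_of_cl_lt K Q)

theorem lowCoeff_disjUnion (P Q : FinQuasiPoset) :
    (P.disjUnion Q).lowCoeff K = P.lowCoeff K * Q.lowCoeff K := by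
  rw [lowCoeff, lowCoeff, lowCoeff, cc_disjUnion, ehrStrPoly_disjUnion]
  obtain ⟨p, hp⟩ := X_pow_cc_dvd_ehrStrPoly K P
  obtain ⟨q, hq⟩ := X_pow_cc_dvd_ehrStrPoly K Q
  rw [hp, hq, show X ^ P.cc * p * (X ^ Q.cc * q) = X ^ (P.cc + Q.cc) * (p * q) by ring]
  simp [coeff_X_pow_mul', mul_coeff_zero]

theorem topCoeff_of_isDiscrete (P : FinQuasiPoset) (h : P.IsDiscrete) : P.topCoeff K = 1 := by
  rw [topCoeff, ehrStrPoly_of_isDiscrete K P h, coeff_X_pow_self]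

theorem topCoeff_empty : empty.topCoeff K = 1 :=
  topCoeff_of_isDiscrete K _ fun x => x.elim

theorem lowCoeff_empty : empty.lowCoeff K = 1 := by
  have : IsEmpty empty := inferInstanceAs (IsEmpty Empty)
  rw [lowCoeff, cc_empty, ehrStrPoly_of_isEmpty, coeff_one_zero]

theorem cl_oneClass {n : ℕ} (h : 1 ≤ n) : (oneClass n).cl = 1 := by
  rw [cl_eq_card, Nat.card_eq_one_iff_unique]
  exact ⟨⟨by rintro ⟨a⟩ ⟨b⟩; exact Quotient.sound ⟨trivial, trivial⟩⟩,
    ⟨Quotient.mk _ (⟨0, h⟩ : Fin n)⟩⟩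

end FinQuasiPoset

/-! ### Morphisms and characters in coordinates -/

namespace Hqp

open FinQuasiPoset Polynomial

variable {K : Type*} [Field K]

theorem pairing_map_Delta (f g : K[X] →ₗ[K] K) (φ ψ : Hqp K →ₗ[K] K[X]) (P : FinQuasiPoset) :
    pairing f g (TensorProduct.map φ ψ (Delta K (cls K P))) =
      ∑ O : UpperSet P, f (φ (cls K (P.restrict {x | x ∉ O}))) *
        g (ψ (cls K (P.restrict {x | x ∈ O}))) := by
  simp only [Delta_cls, map_sum, TensorProduct.map_tmul, pairing_tmul]

theorem pairing_map_delta (f g : K[X] →ₗ[K] K) (φ ψ : Hqp K →ₗ[K] K[X]) (P : FinQuasiPoset) :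
    pairing f g (TensorProduct.map φ ψ (delta K (cls K P))) =
      ∑ r : {r : Setoid P // P.Compatible r}, f (φ (cls K (P.contract r.1))) *
        g (ψ (cls K (P.restrictRel r.1))) := by
  simp only [delta_cls, map_sum, TensorProduct.map_tmul, pairing_tmul]

theorem isBialgebraMorphism_of_cls {ΔA : Hqp K →ₗ[K] Hqp K ⊗[K] Hqp K} {εA : Hqp K →ₗ[K] K}
    {ΔB : K[X] →ₗ[K] K[X] ⊗[K] K[X]} {εB : K[X] →ₗ[K] K} {φ : Hqp K →ₗ[K] K[X]}
    (h_one : φ (cls K empty) = 1)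
    (h_mul : ∀ P Q : FinQuasiPoset, φ (cls K (P.disjUnion Q)) = φ (cls K P) * φ (cls K Q))
    (h_comul : ∀ P, ΔB (φ (cls K P)) = TensorProduct.map φ φ (ΔA (cls K P)))
    (h_counit : ∀ P, εB (φ (cls K P)) = εA (cls K P)) :
    IsBialgebraMorphism ΔA εA ΔB εB φ where
  map_one := h_one
  map_mul := map_mul_of_cls φ h_mul
  map_comul := LinearMap.congr_fun
    (lhom_ext_cls (φ := ΔB ∘ₗ φ) (ψ := TensorProduct.map φ φ ∘ₗ ΔA) h_comul)
  map_counit := LinearMap.congr_fun (lhom_ext_cls (φ := εB ∘ₗ φ) (ψ := εA) h_counit)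

theorem IsHopfMorphism.eval_add {φ : Hqp K →ₗ[K] K[X]} (h : IsHopfMorphism φ) (P : FinQuasiPoset)
    (x y : K) : (φ (cls K P)).eval (x + y) =
      ∑ O : UpperSet P, (φ (cls K (P.restrict {x | x ∉ O}))).eval x *
        (φ (cls K (P.restrict {x | x ∈ O}))).eval y := by
  rw [← PolyBialg.pairing_leval_Delta, h.map_comul, pairing_map_Delta]
  rfl

theorem IsHopfMorphism.choose_mul_coeff {φ : Hqp K →ₗ[K] K[X]} (h : IsHopfMorphism φ)
    (P : FinQuasiPoset) (i j : ℕ) : (i + j).choose i * (φ (cls K P)).coeff (i + j) =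
      ∑ O : UpperSet P, (φ (cls K (P.restrict {x | x ∉ O}))).coeff i *
        (φ (cls K (P.restrict {x | x ∈ O}))).coeff j := by
  rw [← PolyBialg.pairing_lcoeff_Delta, h.map_comul, pairing_map_Delta]
  rfl

theorem IsDeltaMorphism.ite_coeff {φ : Hqp K →ₗ[K] K[X]} (h : IsDeltaMorphism φ)
    (P : FinQuasiPoset) (i j : ℕ) : (if i = j then (φ (cls K P)).coeff i else 0) =
      ∑ r : {r : Setoid P // P.Compatible r}, (φ (cls K (P.contract r.1))).coeff i *
        (φ (cls K (P.restrictRel r.1))).coeff j := by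
  rw [← PolyBialg.pairing_lcoeff_delta, h.map_comul, pairing_map_delta]
  rfl

theorem IsHopfMorphism.eval_zero {φ : Hqp K →ₗ[K] K[X]} (h : IsHopfMorphism φ)
    (P : FinQuasiPoset) : (φ (cls K P)).eval 0 = eps K (cls K P) := by
  rw [← h.map_counit]
  rfl

theorem IsDeltaMorphism.eval_one {φ : Hqp K →ₗ[K] K[X]} (h : IsDeltaMorphism φ)
    (P : FinQuasiPoset) : (φ (cls K P)).eval 1 = eps' K (cls K P) := by
  rw [← h.map_counit]
  rfl

theorem act_cls (φ : Hqp K →ₗ[K] K[X]) (χ : Hqp K →ₐ[K] K) (P : FinQuasiPoset) :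
    act φ χ (cls K P) = ∑ r : {r : Setoid P // P.Compatible r},
      χ (cls K (P.restrictRel r.1)) • φ (cls K (P.contract r.1)) := by
  simp [act, delta_cls]

theorem conv_cls (χ ψ : Hqp K →ₐ[K] K) (P : FinQuasiPoset) :
    conv χ ψ (cls K P) = ∑ r : {r : Setoid P // P.Compatible r},
      χ (cls K (P.contract r.1)) * ψ (cls K (P.restrictRel r.1)) := by
  simp [conv, delta_cls]

/-- The normalization fixes all linear coefficients, which is what makes φ₀ unique. -/
theorem IsHomogeneousNormalized.coeff_one {φ : Hqp K →ₗ[K] K[X]} (h : IsHomogeneousNormalized φ)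
    (P : FinQuasiPoset) : (φ (cls K P)).coeff 1 = if P.cl = 1 then 1 else 0 := by
  split_ifs with hP
  · obtain ⟨n, hn, hPn⟩ := P.exists_equiv_oneClass hP
    rw [cls_congr K hPn, h.map_oneClass n hn, coeff_X_one]
  · obtain ⟨c, hc⟩ := h.homogeneous P
    rw [hc, coeff_C_mul_X_pow, if_neg (Ne.symm hP)]

variable (K) in
/-- The homogeneous morphism `φ₀`. -/
noncomputable def phi₀ : Hqp K →ₗ[K] K[X] :=
  linLift K (fun P => C (P.topCoeff K) * X ^ P.cl) fun P Q h => by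
    simp only [topCoeff_congr K h, cl_congr h]

theorem phi₀_cls (P : FinQuasiPoset) : phi₀ K (cls K P) = C (P.topCoeff K) * X ^ P.cl :=
  linLift_cls _ _ _ _

theorem coeff_phi₀_cls (P : FinQuasiPoset) (i : ℕ) :
    (phi₀ K (cls K P)).coeff i = if i = P.cl then P.topCoeff K else 0 := by
  rw [phi₀_cls, coeff_C_mul_X_pow]

variable [CharZero K]

/-! ### The Ehrhart morphism, and what determines a Hopf morphism -/

variable (K) in
theorem isHopfMorphism_ehrStr : IsHopfMorphism (ehrStr K) := by
  refine isBialgebraMorphism_of_cls ?_ (fun P Q => ?_) (fun P => ?_) fun P => ?_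
  · have : IsEmpty empty := inferInstanceAs (IsEmpty Empty)
    rw [ehrStr_cls, ehrStrPoly_of_isEmpty]
  · simp only [ehrStr_cls, ehrStrPoly_disjUnion]
  · refine eq_of_pairing (fun k : ℕ => leval (k : K)) (fun k : ℕ => leval (k : K))
      PolyBialg.eq_zero_of_leval PolyBialg.eq_zero_of_leval fun k l => ?_
    rw [PolyBialg.pairing_leval_Delta, pairing_map_Delta]
    simp only [ehrStr_cls, leval_apply, eval_ehrStrPoly, ← Nat.cast_add]
    rw [card_strictMaps_add, finsum_eq_sum_of_fintype]
    push_cast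
    rfl
  · rw [ehrStr_cls, eps_cls]
    exact eval_zero_ehrStrPoly K P

variable (K) in
theorem isDeltaMorphism_ehrStr : IsDeltaMorphism (ehrStr K) := by
  have h := isHopfMorphism_ehrStr K
  refine isBialgebraMorphism_of_cls h.map_one (fun P Q => ?_) (fun P => ?_) fun P => ?_
  · rw [cls_disjUnion, h.map_mul]
  · refine eq_of_pairing (fun k : ℕ => leval (k : K)) (fun k : ℕ => leval (k : K))
      PolyBialg.eq_zero_of_leval PolyBialg.eq_zero_of_leval fun k l => ?_
    rw [PolyBialg.pairing_leval_delta, pairing_map_delta]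
    simp only [ehrStr_cls, leval_apply, eval_ehrStrPoly, ← Nat.cast_mul]
    rw [card_strictMaps_mul, finsum_eq_sum_of_fintype]
    push_cast
    rfl
  · rw [ehrStr_cls, eps'_cls]
    exact eval_one_ehrStrPoly K P

/-- A Hopf algebra morphism to `K[X]` is determined by its evaluation at `1`. -/
theorem IsHopfMorphism.eq_of_eval_one {φ ψ : Hqp K →ₗ[K] K[X]} (hφ : IsHopfMorphism φ)
    (hψ : IsHopfMorphism ψ) (h : ∀ P, (φ (cls K P)).eval 1 = (ψ (cls K P)).eval 1) : φ = ψ := by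
  refine lhom_ext_cls fun P => PolyBialg.eq_of_eval_natCast fun k => ?_
  induction k generalizing P with
  | zero => rw [Nat.cast_zero, hφ.eval_zero, hψ.eval_zero]
  -- Δ expresses the value at `k + 1` through values at `k` and at `1`.
  | succ k ih => simp only [Nat.cast_succ, hφ.eval_add, hψ.eval_add, h, ih]

/-- A Hopf algebra morphism to `K[X]` is determined by its coefficients of degree `1`. -/
theorem IsHopfMorphism.eq_of_coeff_one {φ ψ : Hqp K →ₗ[K] K[X]} (hφ : IsHopfMorphism φ)
    (hψ : IsHopfMorphism ψ)
    (h : ∀ P : FinQuasiPoset, (φ (cls K P)).coeff 1 = (ψ (cls K P)).coeff 1) : φ = ψ := by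
  have key : ∀ j (P : FinQuasiPoset), (φ (cls K P)).coeff j = (ψ (cls K P)).coeff j := by
    intro j
    induction j with
    | zero => intro P; rw [coeff_zero_eq_eval_zero, coeff_zero_eq_eval_zero, hφ.eval_zero,
        hψ.eval_zero]
    | succ j ih =>
      intro P
      -- The binomial factor is `j + 1`, invertible in characteristic zero, so degrees `1` and `j`
      -- determine degree `j + 1`.
      have h₁ := hφ.choose_mul_coeff P 1 j
      have h₂ := hψ.choose_mul_coeff P 1 j
      simp only [h, ih] at h₁
      rw [← h₂, add_comm 1 j, Nat.choose_one_right] at h₁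
      exact mul_left_cancel₀ (Nat.cast_ne_zero.2 j.succ_ne_zero) h₁
  exact lhom_ext_cls fun P => Polynomial.ext fun j => key j P

/-- The character with prescribed multiplicative values on quasi-posets. -/
noncomputable def charLift (F : FinQuasiPoset → K) (hF : ∀ P Q, P ≈ Q → F P = F Q)
    (h_one : F empty = 1) (h_mul : ∀ P Q : FinQuasiPoset, F (P.disjUnion Q) = F P * F Q) :
    Hqp K →ₐ[K] K :=
  AlgHom.ofLinearMap (linLift K F hF) ((linLift_cls K F hF _).trans h_one)
    (map_mul_of_cls _ fun P Q => by simp only [linLift_cls, h_mul])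

variable (K) in
/-- The character `P ↦ μ_P / cl(P)!`. -/
noncomputable def lam : Hqp K →ₐ[K] K :=
  charLift (topCoeff K) (fun _ _ => topCoeff_congr K) (topCoeff_empty K) (topCoeff_disjUnion K)

variable (K) in
/-- The character `α^str`. -/
noncomputable def alphaStr : Hqp K →ₐ[K] K :=
  charLift (lowCoeff K) (fun _ _ => lowCoeff_congr K) (lowCoeff_empty K) (lowCoeff_disjUnion K)

theorem lam_cls (P : FinQuasiPoset) : lam K (cls K P) = P.topCoeff K :=
  linLift_cls _ _ _ _

theorem alphaStr_cls (P : FinQuasiPoset) : alphaStr K (cls K P) = P.lowCoeff K :=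
  linLift_cls _ _ _ _

-- Compatibility with Δ is the component of total degree `cl P` of the same identity for `ehrStr`.
variable (K) in
theorem isHopfMorphism_phi₀ : IsHopfMorphism (phi₀ K) := by
  refine isBialgebraMorphism_of_cls ?_ (fun P Q => ?_) (fun P => ?_) fun P => ?_
  · rw [phi₀_cls, topCoeff_empty, cl_empty, C_1, pow_zero, mul_one]
  · simp only [phi₀_cls, topCoeff_disjUnion, cl_disjUnion, C_mul, pow_add]
    ring
  · refine eq_of_pairing (fun i => lcoeff K i) (fun i => lcoeff K i)
      PolyBialg.eq_zero_of_lcoeff PolyBialg.eq_zero_of_lcoeff fun i j => ?_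
    rw [PolyBialg.pairing_lcoeff_Delta, pairing_map_Delta]
    simp only [lcoeff_apply, coeff_phi₀_cls]
    by_cases hij : i + j = P.cl
    · rw [if_pos hij, topCoeff, ← hij]
      have h := (isHopfMorphism_ehrStr K).choose_mul_coeff P i j
      simp only [ehrStr_cls] at h
      rw [h]
      refine Finset.sum_congr rfl fun O _ => ?_
      have hO := P.cl_restrict_add O
      -- Since `i + j` is the sum of the two class numbers, unless `i` and `j` equal them
      -- respectively, one of the two exceeds the degree bound of its factor.
      rcases lt_trichotomy i (P.restrict {x | x ∉ O}).cl with hi | hi | hi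
      · rw [if_neg hi.ne, zero_mul, coeff_ehrStrPoly_of_cl_lt K (P.restrict {x | x ∈ O}) (by omega),
          mul_zero]
      · rw [if_pos hi, if_pos (by omega), topCoeff, topCoeff, ← hi,
          show j = (P.restrict {x | x ∈ O}).cl by omega]
      · rw [if_neg hi.ne', zero_mul, coeff_ehrStrPoly_of_cl_lt K _ hi, zero_mul]
    · rw [if_neg hij, mul_zero]
      refine (Finset.sum_eq_zero fun O _ => ?_).symm
      have hO := P.cl_restrict_add O
      by_cases hi : i = (P.restrict {x | x ∉ O}).cl
      · rw [if_neg (by omega : ¬ j = (P.restrict {x | x ∈ O}).cl), mul_zero]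
      · rw [if_neg hi, zero_mul]
  · rw [phi₀_cls, eps_cls]
    change aeval (0 : K) _ = _
    rw [← coeff_zero_eq_aeval_zero, coeff_C_mul_X_pow]
    split_ifs with h₁ h₂ h₂
    · rw [topCoeff_congr K P.equiv_empty, topCoeff_empty]
    · have := not_isEmpty_iff.1 h₂
      exact absurd h₁ P.cl_pos.ne
    · exact absurd (cl_congr P.equiv_empty |>.trans cl_empty).symm h₁
    · rfl

variable (K) in
theorem isHomogeneousNormalized_phi₀ : IsHomogeneousNormalized (phi₀ K) where
  isHopfMorphism := isHopfMorphism_phi₀ K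
  homogeneous P := ⟨_, phi₀_cls P⟩
  map_oneClass n hn := by
    rw [phi₀_cls, topCoeff_of_isDiscrete K _ fun _ _ _ => trivial, cl_oneClass hn, C_1, one_mul,
      pow_one]

theorem IsHomogeneousNormalized.unique {φ ψ : Hqp K →ₗ[K] K[X]} (hφ : IsHomogeneousNormalized φ)
    (hψ : IsHomogeneousNormalized ψ) : φ = ψ :=
  hφ.isHopfMorphism.eq_of_coeff_one hψ.isHopfMorphism fun P => by
    rw [hφ.coeff_one, hψ.coeff_one]

/-! ### The character α and its inverse λ -/

/-- Diagonal coefficients of the δ-identity: the number of classes of `r` bounds the degree for `P /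
r` from above and the valuation for `P | r` from below, so only degree `i` equal to it contributes.
-/
theorem ehrStr_eq_act : ehrStr K = act (phi₀ K) (alphaStr K) := by
  refine lhom_ext_cls fun P => Polynomial.ext fun i => ?_
  have h := (isDeltaMorphism_ehrStr K).ite_coeff P i i
  rw [if_pos rfl] at h
  rw [h, act_cls, finsetSum_coeff]
  refine Finset.sum_congr rfl fun ⟨r, hr⟩ _ => ?_
  have hcl := hr.cl_contract
  have hcc := hr.cc_restrictRel
  rw [coeff_smul, coeff_phi₀_cls, alphaStr_cls, ehrStr_cls, ehrStr_cls, smul_eq_mul, mul_comm,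
    lowCoeff, topCoeff, hcl, hcc]
  rcases lt_trichotomy i (Nat.card (Quotient r)) with hi | hi | hi
  · rw [if_neg hi.ne, coeff_ehrStrPoly_of_lt_cc K _ (hcc.symm ▸ hi), zero_mul, mul_zero]
  · rw [if_pos hi, ← hi]
  · rw [if_neg hi.ne', coeff_ehrStrPoly_of_cl_lt K (P.contract r) (hcl.symm ▸ hi), mul_zero, mul_zero]

/-- In `φ₀ ← β`, the coefficient of degree `cc P` at `P` is the value of `β`. -/
theorem coeff_act_phi₀ (β : Hqp K →ₐ[K] K) (P : FinQuasiPoset) :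
    (act (phi₀ K) β (cls K P)).coeff P.cc = β (cls K P) := by
  -- The term of `r` is homogeneous of degree its number of classes; as `r` refines the component
  -- relation, this is `cc P` only for the component relation itself.
  rw [act_cls, finsetSum_coeff, Finset.sum_eq_single ⟨P.connSetoid, P.compatible_connSetoid⟩]
  · have hcl : (P.contract P.connSetoid).cl = P.cc := P.compatible_connSetoid.cl_contract
    rw [coeff_smul, coeff_phi₀_cls, if_pos hcl.symm,
      topCoeff_of_isDiscrete K _ P.isDiscrete_contract_connSetoid, smul_eq_mul, mul_one,
      cls_congr K P.restrictRel_connSetoid]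
  · rintro ⟨r, hr⟩ _ hne
    rw [coeff_smul, coeff_phi₀_cls, if_neg, smul_zero]
    intro h
    rw [hr.cl_contract] at h
    exact hne (Subtype.ext (eq_of_le_of_card_quotient hr.le_connSetoid h.symm))
  · intro h
    exact absurd (Finset.mem_univ _) h

theorem eq_alphaStr_of_act {β : Hqp K →ₐ[K] K} (h : ehrStr K = act (phi₀ K) β) :
    β = alphaStr K := by
  refine AlgHom.toLinearMap_injective (lhom_ext_cls fun P => ?_)
  change β (cls K P) = alphaStr K (cls K P)
  rw [← coeff_act_phi₀ β, ← coeff_act_phi₀ (alphaStr K), ← h, ← ehrStr_eq_act]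

/-- The coefficient of bidegree `(cc P, cl P)` of the δ-identity: these degrees are `cc (P / r)` and
`cl (P | r)` for every `r`, so each term is α(P / r) λ(P | r). -/
theorem conv_alphaStr_lam : conv (alphaStr K) (lam K) = eps' K := by
  refine lhom_ext_cls fun P => ?_
  have h := (isDeltaMorphism_ehrStr K).ite_coeff P P.cc P.cl
  have h' : conv (alphaStr K) (lam K) (cls K P) = ∑ r : {r : Setoid P // P.Compatible r},
      (ehrStr K (cls K (P.contract r.1))).coeff P.cc *
        (ehrStr K (cls K (P.restrictRel r.1))).coeff P.cl := by
    rw [conv_cls]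
    refine Finset.sum_congr rfl fun r _ => ?_
    rw [alphaStr_cls, lam_cls, ehrStr_cls, ehrStr_cls, lowCoeff, topCoeff, r.2.cc_contract,
      r.2.cl_restrictRel]
  rw [h', ← h, eps'_cls, ehrStr_cls]
  by_cases hP : P.IsDiscrete
  · have hcc := P.isDiscrete_iff_cc_eq_cl.1 hP
    rw [if_pos hP, if_pos hcc, hcc]
    exact topCoeff_of_isDiscrete K P hP
  · rw [if_neg hP, if_neg fun hcc => hP (P.isDiscrete_iff_cc_eq_cl.2 hcc)]

/-- At `1`, φ₀ takes the value λ and `ehrStr` the value ε'. -/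
theorem conv_lam_alphaStr : conv (lam K) (alphaStr K) = eps' K := by
  refine lhom_ext_cls fun P => ?_
  rw [← (isDeltaMorphism_ehrStr K).eval_one, ehrStr_eq_act, act_cls, conv_cls, eval_finsetSum]
  refine Finset.sum_congr rfl fun r _ => ?_
  rw [phi₀_cls, eval_smul, eval_mul, eval_C, eval_pow, eval_X, one_pow, mul_one, smul_eq_mul,
    lam_cls, mul_comm]

theorem alphaStr_of_isConnected (P : FinQuasiPoset) (h : P.IsConnected) :
    alphaStr K (cls K P) = (derivative (P.ehrStrPoly K)).eval 0 := by
  rw [alphaStr_cls, lowCoeff, P.isConnected_iff_cc.1 h, ← coeff_zero_eq_eval_zero, coeff_derivative]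
  simp

end Hqp

theorem theorem37 (K : Type*) [Field K] [CharZero K] :
    (Hqp.IsHopfMorphism (Hqp.ehrStr K) ∧ Hqp.IsDeltaMorphism (Hqp.ehrStr K) ∧
      ∀ φ : Hqp K →ₗ[K] K[X], Hqp.IsHopfMorphism φ → Hqp.IsDeltaMorphism φ → φ = Hqp.ehrStr K) ∧
    ∃ (φ₀ : Hqp K →ₗ[K] K[X]) (lam α : Hqp K →ₐ[K] K),
      (Hqp.IsHomogeneousNormalized φ₀ ∧
        ∀ φ : Hqp K →ₗ[K] K[X], Hqp.IsHomogeneousNormalized φ → φ = φ₀) ∧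
      (∀ P : FinQuasiPoset,
        φ₀ (Hqp.cls K P) = Polynomial.C (lam (Hqp.cls K P)) * Polynomial.X ^ P.cl) ∧
      (∀ P : FinQuasiPoset, lam (Hqp.cls K P) = (P.mu : K) / (Nat.factorial P.cl : K)) ∧
      (Hqp.ehrStr K = Hqp.act φ₀ α ∧
        ∀ β : Hqp K →ₐ[K] K, Hqp.ehrStr K = Hqp.act φ₀ β → β = α) ∧
      (∀ P : FinQuasiPoset, P.IsConnected →
        α (Hqp.cls K P) = (Polynomial.derivative (P.ehrStrPoly K)).eval 0) ∧
      Hqp.conv α lam = Hqp.eps' K ∧ Hqp.conv lam α = Hqp.eps' K := by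
  have hH := Hqp.isHopfMorphism_ehrStr K
  have hD := Hqp.isDeltaMorphism_ehrStr K
  have h₀ := Hqp.isHomogeneousNormalized_phi₀ K
  -- Uniqueness: the counit of δ forces both morphisms to take the value ε' at `1`.
  refine ⟨⟨hH, hD, fun φ h h' => h.eq_of_eval_one hH fun P => by rw [h'.eval_one, hD.eval_one]⟩,
    Hqp.phi₀ K, Hqp.lam K, Hqp.alphaStr K, ⟨h₀, fun φ h => h.unique h₀⟩, fun P => ?_, fun P => ?_,
    ⟨Hqp.ehrStr_eq_act, fun β => Hqp.eq_alphaStr_of_act⟩, Hqp.alphaStr_of_isConnected,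
    Hqp.conv_alphaStr_lam, Hqp.conv_lam_alphaStr⟩
  · rw [Hqp.phi₀_cls, Hqp.lam_cls]
  · rw [Hqp.lam_cls, FinQuasiPoset.topCoeff, FinQuasiPoset.coeff_ehrStrPoly_cl]
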